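/- **Setting.** Let $0\le d<N$, let $M\subset\mathbb R^N$ be a compact $C^2$ $d$-dimensional submanifold (without boundary), and let $P\subset\mathbb R^N$ be a finite set. All balls $B(c,r)$ are closed. For a closed set $A\subseteq\mathbb R^N$, the medial axis of $A$ is the set of points with at least two closest points in $A$; $\mathrm{Reach}(A)\in[0,\infty]$ is the infimum of the distances between $A$ and its medial axis; $\pi_A$ sends a point off the medial axis to its unique closest point in $A$; and $A^{\oplus r}=\{x: d(x,A)\le r\}$. For $m\in M$, $T_mM$ is the tangent (affine) plane of $M$ at $m$ and $\pi_{T_mM}$ is the orthogonal projection onto it. Fix a real number $R$ with $0<R\le\mathrm{Reach}(M)$ and a scale $\rho\ge 0$. **Simplices.** A simplex is a finite nonempty subset $\sigma$ of $\mathbb R^N$; it is a $d$-simplex if it has $d+1$ elements, and it is $\rho$-small if it is contained in a ball of radius $\rho$. A set of simplices is a simplicial complex if it contains every nonempty subset of each of its elements. For a set $\Sigma$ of simplices, $|\Sigma|=\bigcup_{\sigma\in\Sigma}\mathrm{relint}(\mathrm{Conv}\,\sigma)$. We call $\Sigma$ geometrically realized if every $\sigma\in\Sigma$ is affinely independent and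 $\mathrm{Conv}(\alpha\cap\beta)=\mathrm{Conv}\,\alpha\cap\mathrm{Conv}\,\beta$ for all $\alpha,\beta\in\Sigma$. A simplicial complex $K$ is a faithful reconstruction of a set $A$ of positive reach if $K$ is geometrically realized, $|K|\subseteq A^{\oplus r}$ for some $0\le r<\mathrm{Reach}(A)$, and $\pi_A$ restricts to a homeomorphism from $|K|$ onto $A$. **Flat Delaunay complex.** For a finite set $Q$, $\mathrm{Del}(Q)$ is the set of simplices $\sigma\subseteq Q$ for which some $(N-1)$-sphere passes through all points of $\sigma$ and bounds a ball with no point of $Q$ in its interior. For $m\in M$ put $$\mathrm{Star}(m)=\{\tau\in\mathrm{Del}(\pi_{T_mM}(P\cap B(m,\rho))) : m\in\mathrm{Conv}\,\tau\},$$ and, for $x$ off the medial axis of $M$, with $x^*=\pi_M(x)$, put $$\mathrm{Prestar}(x)=\{\sigma\subseteq P\cap B(x^*,\rho) : \pi_{T_{x^*}M}(\sigma)\in\mathrm{Star}(x^*)\}.$$ If no point of $P$ lies on the medial axis of $M$, put $\mathrm{FlatDel}(P,\rho)=\bigcup_{p\in P}\mathrm{Prestar}(p)$. A simplex $\sigma$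 has its prestars in agreement if, for all $x,y\in\mathrm{Conv}\,\sigma$, $\sigma\in\mathrm{Prestar}(x)\iff\sigma\in\mathrm{Prestar}(y)$. **Theorem (Faithful reconstruction from structural conditions).** Suppose that $P\subseteq M^{\oplus\rho}$ with $\rho<\frac R2$, and that 1. for every $\rho$-small $d$-simplex $\sigma\subseteq P$, the restriction of $\pi_M$ to $\mathrm{Conv}\,\sigma$ is injective; 2. for all $m\in M$, the restriction of $\pi_{T_mM}$ to $P\cap B(m,\rho)$ is injective; 3. for all $m\in M$, $|\mathrm{Star}(m)|$ is homeomorphic to $\mathbb R^d$ in a neighborhood of $m$ (that is, $m$ belongs to $|\mathrm{Star}(m)|$ and has an open neighborhood in it that is homeomorphic to $\mathbb R^d$); 4. for all $m\in M$, $\mathrm{Star}(m)$ is geometrically realized; 5. every $\rho$-small $d$-simplex $\sigma\subseteq P$ has its prestars in agreement. Then - $\mathrm{FlatDel}(P,\rho)$ is a simplicial complex; - for all $m\in M$, $\mathrm{Prestar}(m)=\{\sigma\in\mathrm{FlatDel}(P,\rho) : m\in\pi_M(\mathrm{Conv}\,\sigma)\}$; - $\mathrm{FlatDel}(P,\rho)$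 is a faithful reconstruction of $M$. (Since $2\rho<\mathrm{Reach}(M)$, $\pi_M$ is well defined on $P$ and on $\mathrm{Conv}\,\sigma$ for every $\rho$-small simplex $\sigma\subseteq P$.) -/

import Mathlib

open Set Filter Topology
open scoped ENNReal

noncomputable section

namespace FlatDelaunay

/-- The Euclidean space `ℝ^N`. -/
abbrev E (N : ℕ) : Type := EuclideanSpace ℝ (Fin N)

variable {N : ℕ}

/-! ### Closest points, medial axis, reach -/

/-- `y` is a closest point of `x` in `A`. -/
def IsClosestPoint (A : Set (E N)) (x y : E N) : Prop :=
  y ∈ A ∧ ∀ z ∈ A, dist x y ≤ dist x z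

/-- The medial axis: the points with at least two closest points in `A`. -/
def medialAxis (A : Set (E N)) : Set (E N) :=
  {x | ∃ y z, y ≠ z ∧ IsClosestPoint A x y ∧ IsClosestPoint A x z}

/-- The reach: the infimum of the distances between `A` and the points of its medial axis
(infinite if the medial axis is empty). -/
def reach (A : Set (E N)) : ℝ≥0∞ := ⨅ x ∈ medialAxis A, Metric.infEDist x A

/-- The tubular neighborhood `{x | d(x, A) ≤ r}`; distances to the empty set are infinite. -/
def tube (A : Set (E N)) (r : ℝ) : Set (E N) :=
  {x | Metric.infEDist x A ≤ ENNReal.ofReal r}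

open Classical in
/-- The projection map `π_A`, which sends `x` to its closest point in `A`. It is only meaningful
where there is exactly one closest point (for a nonempty closed `A`: off the medial axis). -/
def proj (A : Set (E N)) (x : E N) : E N :=
  if h : ∃ y, IsClosestPoint A x y then h.choose else x

/-! ### Submanifolds and tangent planes -/

/-- `M` is a `d`-dimensional `C²` submanifold (without boundary) of `ℝ^N`: around each of its
points there is a `C²` diffeomorphism between open subsets of `ℝ^N` that flattens `M` onto
`ℝ^d × {0}`. -/
def IsC2Submanifold (d : ℕ) (M : Set (E N)) : Prop :=
  ∀ m ∈ M, ∃ Φ : OpenPartialHomeomorph (E N) (E N), m ∈ Φ.source ∧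
    ContDiffOn ℝ 2 Φ Φ.source ∧ ContDiffOn ℝ 2 Φ.symm Φ.target ∧
    ∀ x ∈ Φ.source, (x ∈ M ↔ ∀ i : Fin N, d ≤ (i : ℕ) → Φ x i = 0)

/-- The direction of the tangent plane to `M` at `m`: the vector space of velocities at `m` of
curves drawn on `M` (for a submanifold these velocities already form a linear space). -/
def tangentDirection (M : Set (E N)) (m : E N) : Submodule ℝ (E N) :=
  Submodule.span ℝ {v | ∃ γ : ℝ → E N, γ 0 = m ∧ (∀ᶠ t in 𝓝 0, γ t ∈ M) ∧ HasDerivAt γ v 0}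

/-- The orthogonal projection of `ℝ^N` onto the tangent plane `T_m M = m + tangentDirection M m`. -/
def tangentProj (M : Set (E N)) (m x : E N) : E N :=
  m + (tangentDirection M m).starProjection (x - m)

/-! ### Abstract simplices with vertices in `ℝ^N` -/

/-- An abstract simplicial complex: a collection of nonempty finite sets that contains every
nonempty subset of each of its elements. -/
def IsSimplicialComplex (K : Set (Finset (E N))) : Prop :=
  ∀ σ ∈ K, σ.Nonempty ∧ ∀ τ ⊆ σ, τ.Nonempty → τ ∈ K

/-- The geometric simplex associated to an abstract simplex. -/
def conv (σ : Finset (E N)) : Set (E N) := convexHull ℝ (σ : Set (E N))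

/-- `σ` can be enclosed in a (closed) ball of radius `ρ`. -/
def IsSmall (ρ : ℝ) (σ : Finset (E N)) : Prop :=
  ∃ c : E N, (σ : Set (E N)) ⊆ Metric.closedBall c ρ

/-- `σ` is a `ρ`-small abstract `d`-simplex with vertices in `P`. -/
def IsSmallSimplex (P : Set (E N)) (d : ℕ) (ρ : ℝ) (σ : Finset (E N)) : Prop :=
  (σ : Set (E N)) ⊆ P ∧ σ.card = d + 1 ∧ IsSmall ρ σ

/-- The shadow of a set of simplices: the subset of `ℝ^N` covered by the relative interiors of the
geometric simplices. -/
def shadow (K : Set (Finset (E N))) : Set (E N) :=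
  ⋃ σ ∈ K, intrinsicInterior ℝ (conv σ)

/-- `K` is geometrically realized: all simplices are non-degenerate, and the geometric simplices
of two of them meet along the geometric simplex of their intersection. -/
structure IsGeometricallyRealized (K : Set (Finset (E N))) : Prop where
  nondegenerate : ∀ σ ∈ K, AffineIndependent ℝ ((↑) : σ → E N)
  inter : ∀ α ∈ K, ∀ β ∈ K,
    convexHull ℝ ((α : Set (E N)) ∩ (β : Set (E N))) = conv α ∩ conv β

/-- `K` is a faithful reconstruction of `A` (a notion used for `A` of positive reach). -/
structure IsFaithfulReconstruction (K : Set (Finset (E N))) (A : Set (E N)) : Prop where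
  complex : IsSimplicialComplex K
  embedding : IsGeometricallyRealized K
  closeness : ∃ r : ℝ, 0 ≤ r ∧ ENNReal.ofReal r < reach A ∧ shadow K ⊆ tube A r
  homeomorphism : ∃ e : shadow K ≃ₜ A, ∀ x : shadow K, (e x : E N) = proj A x

/-- `X` is homeomorphic to `ℝ^d` in a neighborhood of its point `m`. -/
def IsLocallyEuclideanAt (d : ℕ) (X : Set (E N)) (m : E N) : Prop :=
  m ∈ X ∧ ∃ U : Set (E N), IsOpen U ∧ m ∈ U ∧ Nonempty ((X ∩ U : Set (E N)) ≃ₜ E d)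

/-! ### The flat Delaunay complex -/

/-- The Delaunay complex of a (finite) set `Q`: the simplices with vertices in `Q` that are
circumscribed by a sphere bounding a ball with no point of `Q` in its interior. -/
def delaunay (Q : Set (E N)) : Set (Finset (E N)) :=
  {σ | σ.Nonempty ∧ (σ : Set (E N)) ⊆ Q ∧
    ∃ (c : E N) (r : ℝ), 0 < r ∧ (∀ v ∈ σ, dist v c = r) ∧ ∀ q ∈ Q, r ≤ dist q c}

/-- The star of `m ∈ M` at scale `ρ`. -/
def star (M P : Set (E N)) (ρ : ℝ) (m : E N) : Set (Finset (E N)) :=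
  {τ | τ ∈ delaunay (tangentProj M m '' (P ∩ Metric.closedBall m ρ)) ∧ m ∈ conv τ}

open Classical in
/-- The prestar of `x` at scale `ρ`. -/
def prestar (M P : Set (E N)) (ρ : ℝ) (x : E N) : Set (Finset (E N)) :=
  {σ | (σ : Set (E N)) ⊆ P ∩ Metric.closedBall (proj M x) ρ ∧
    σ.image (tangentProj M (proj M x)) ∈ star M P ρ (proj M x)}

/-- The flat Delaunay complex of `P` with respect to `M` at scale `ρ`. -/
def flatDel (M P : Set (E N)) (ρ : ℝ) : Set (Finset (E N)) :=
  ⋃ p ∈ P, prestar M P ρ p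

/-- The prestars of `σ` are in agreement at scale `ρ`. -/
def PrestarsAgree (M P : Set (E N)) (ρ : ℝ) (σ : Finset (E N)) : Prop :=
  ∀ x ∈ conv σ, ∀ y ∈ conv σ, (σ ∈ prestar M P ρ x ↔ σ ∈ prestar M P ρ y)

end FlatDelaunay

end

open Set Filter Topology
open scoped ENNReal

noncomputable section

namespace FlatDelaunay

section Brouwer

open MeasureTheory Metric

variable {F : Type*} [NormedAddCommGroup F] [InnerProductSpace ℝ F] [FiniteDimensional ℝ F]

lemma exists_polynomial_det_id_add_smul (A : F →L[ℝ] F) :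
    ∃ p : Polynomial ℝ, p.natDegree ≤ Module.finrank ℝ F ∧
      ∀ t : ℝ, (ContinuousLinearMap.id ℝ F + t • A).det = p.eval t := by
  classical
  let b := Module.finBasis ℝ F
  let B := LinearMap.toMatrix b b (A : F →ₗ[ℝ] F)
  refine ⟨Matrix.det ((Polynomial.X : Polynomial ℝ) • B.map Polynomial.C
      + (1 : Matrix _ _ ℝ).map Polynomial.C), ?_, fun t => ?_⟩
  · simpa using Polynomial.natDegree_det_X_add_C_le B 1
  · have h1 : (ContinuousLinearMap.id ℝ F + t • A).det
        = Matrix.det (LinearMap.toMatrix b b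
          ((ContinuousLinearMap.id ℝ F + t • A : F →L[ℝ] F) : F →ₗ[ℝ] F)) :=
      (LinearMap.det_toMatrix b _).symm
    have h2 : LinearMap.toMatrix b b
        ((ContinuousLinearMap.id ℝ F + t • A : F →L[ℝ] F) : F →ₗ[ℝ] F) = t • B + 1 := by
      have : ((ContinuousLinearMap.id ℝ F + t • A : F →L[ℝ] F) : F →ₗ[ℝ] F)
          = LinearMap.id + t • (A : F →ₗ[ℝ] F) := rfl
      rw [this, map_add, map_smul, LinearMap.toMatrix_id, add_comm]
    rw [h1, h2, ← Polynomial.coe_evalRingHom, RingHom.map_det]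
    congr 1
    ext i j
    by_cases hij : i = j
    · subst hij
      simp
      ring
    · simp [Matrix.one_apply_ne hij]
      ring

lemma det_id_add_smul_pos {A : F →L[ℝ] F} {C : ℝ} (hA : ‖A‖ ≤ C) {t : ℝ} (ht : 0 ≤ t)
    (htC : t * C < 1) : 0 < (ContinuousLinearMap.id ℝ F + t • A).det := by
  have hC : 0 ≤ C := (norm_nonneg _).trans hA
  have hne : ∀ s ∈ Icc (0 : ℝ) t, (ContinuousLinearMap.id ℝ F + s • A).det ≠ 0 := by
    intro s hs h0
    have hinj : LinearMap.ker
        ((ContinuousLinearMap.id ℝ F + s • A : F →L[ℝ] F) : F →ₗ[ℝ] F) = ⊥ := by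
      rw [LinearMap.ker_eq_bot']
      intro v hv
      have hv' : v = -(s • A v) := by
        have : v + s • A v = 0 := hv
        exact eq_neg_of_add_eq_zero_left this
      have h1 : ‖v‖ ≤ s * (C * ‖v‖) := by
        conv_lhs => rw [hv', norm_neg, norm_smul, Real.norm_of_nonneg hs.1]
        have := A.le_opNorm v
        have := hs.1
        gcongr
        exact (A.le_opNorm v).trans (by gcongr)
      have h2 : s * C < 1 := lt_of_le_of_lt (by have := hs.2; gcongr) htC
      have h3 : ‖v‖ ≤ 0 := by nlinarith [norm_nonneg v]
      exact norm_le_zero_iff.1 h3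
    have := LinearMap.bot_lt_ker_of_det_eq_zero (f := ((ContinuousLinearMap.id ℝ F + s • A : F →L[ℝ] F) : F →ₗ[ℝ] F)) h0
    exact this.ne' hinj
  obtain ⟨p, -, hp⟩ := exists_polynomial_det_id_add_smul A
  have hcont : ContinuousOn (fun s : ℝ => p.eval s) (Icc 0 t) := p.continuous.continuousOn
  by_contra hneg
  rw [hp] at hneg
  have h0 : p.eval 0 = 1 := by rw [← hp]; simp [ContinuousLinearMap.det]
  have := intermediate_value_Icc' ht hcont
  obtain ⟨s, hs, hs0⟩ := this ⟨not_lt.1 hneg, by rw [h0]; exact zero_le_one⟩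
  exact hne s hs (by rw [hp]; exact hs0)

lemma bijective_id_add_smul {g : F → F} {C : NNReal} (hg : LipschitzWith C g) {t : ℝ} (ht : 0 ≤ t)
    (htC : t * C < 1) : Function.Bijective fun x => x + t • g x := by
  constructor
  · intro x y hxy
    have h1 : x - y = t • (g y - g x) := by
      have : x + t • g x = y + t • g y := hxy
      rw [smul_sub, sub_eq_sub_iff_add_eq_add, this]
      abel
    have h2 : ‖x - y‖ ≤ t * (C * ‖x - y‖) := by
      conv_lhs => rw [h1, norm_smul, Real.norm_of_nonneg ht]
      gcongr
      rw [norm_sub_rev x y]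
      exact hg.norm_sub_le y x
    have h3 : ‖x - y‖ ≤ 0 := by nlinarith [norm_nonneg (x - y)]
    exact sub_eq_zero.1 (norm_le_zero_iff.1 h3)
  · intro y
    let K : NNReal := ⟨t, ht⟩ * C
    have hK : ContractingWith K fun z => y - t • g z := by
      refine ⟨by exact_mod_cast htC, LipschitzWith.of_dist_le_mul fun a b => ?_⟩
      have : (y - t • g a) - (y - t • g b) = t • (g b - g a) := by rw [smul_sub]; abel
      rw [dist_eq_norm, this, norm_smul, Real.norm_of_nonneg ht, dist_comm, dist_eq_norm]
      have := hg.norm_sub_le b a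
      calc t * ‖g b - g a‖ ≤ t * (C * ‖b - a‖) := by gcongr
        _ = K * ‖b - a‖ := by rw [← mul_assoc]; rfl
    refine ⟨hK.fixedPoint, ?_⟩
    have := hK.fixedPoint_isFixedPt
    have h : y - t • g hK.fixedPoint = hK.fixedPoint := this
    change hK.fixedPoint + t • g hK.fixedPoint = y
    nth_rewrite 1 [← h]
    abel

omit [FiniteDimensional ℝ F] in
lemma lipschitzWith_indicator_ball {g : F → F} {C : NNReal}
    (hg : LipschitzOnWith C g (closedBall 0 1)) (h0 : ∀ x ∈ sphere (0 : F) 1, g x = 0) :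
    LipschitzWith C ((ball (0 : F) 1).indicator g) := by
  have key : ∀ x ∈ ball (0 : F) 1, ∀ y ∉ ball (0 : F) 1, dist (g x) 0 ≤ C * dist x y := by
    intro x hx y hy
    have hcont : Continuous fun t : ℝ => ‖AffineMap.lineMap x y t‖ :=
      (AffineMap.lineMap_continuous).norm
    have := intermediate_value_Icc (zero_le_one (α := ℝ)) hcont.continuousOn
    obtain ⟨t, ht, ht1⟩ := this (show (1 : ℝ) ∈ _ by
      simp only [mem_ball_zero_iff, not_lt] at hx hy
      simpa using ⟨hx.le, hy⟩)
    set z := AffineMap.lineMap x y t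
    have hz : z ∈ sphere (0 : F) 1 := by simpa using ht1
    rw [← h0 z hz]
    refine (hg.dist_le_mul x (ball_subset_closedBall hx) z (sphere_subset_closedBall hz)).trans ?_
    gcongr
    rw [dist_left_lineMap, Real.norm_of_nonneg ht.1]
    exact mul_le_of_le_one_left dist_nonneg ht.2
  refine LipschitzWith.of_dist_le_mul fun x y => ?_
  by_cases hx : x ∈ ball (0 : F) 1 <;> by_cases hy : y ∈ ball (0 : F) 1
  · rw [indicator_of_mem hx, indicator_of_mem hy]
    exact hg.dist_le_mul x (ball_subset_closedBall hx) y (ball_subset_closedBall hy)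
  · rw [indicator_of_mem hx, indicator_of_notMem hy]
    exact key x hx y hy
  · rw [indicator_of_notMem hx, indicator_of_mem hy, dist_comm, dist_comm x]
    exact key y hy x hx
  · rw [indicator_of_notMem hx, indicator_of_notMem hy, dist_self]
    positivity

lemma det_fderiv_eq_zero_of_norm_eq_one {f : F → F} {f' : F →L[ℝ] F} {x : F}
    (hf : HasFDerivAt f f' x) (h : ∀ᶠ y in 𝓝 x, ‖f y‖ = 1) : f'.det = 0 := by
  by_contra hdet
  have hsurj : Function.Surjective f' := by
    have hu : IsUnit (f' : F →ₗ[ℝ] F) := by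
      rw [LinearMap.isUnit_iff_isUnit_det]
      exact isUnit_iff_ne_zero.2 hdet
    exact ((Module.End.isUnit_iff _).1 hu).2
  obtain ⟨v, hv⟩ := hsurj (f x)
  have h1 : HasFDerivAt (fun y => ‖f y‖ ^ 2) (2 • (innerSL ℝ (f x)).comp f') x := hf.norm_sq
  have h2 : HasFDerivAt (fun y => ‖f y‖ ^ 2) (0 : F →L[ℝ] ℝ) x :=
    (hasFDerivAt_const (1 : ℝ) x).congr_of_eventuallyEq (h.mono fun y hy => by simp [hy])
  have h3 := DFunLike.congr_fun (h1.unique h2) v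
  have h4 : ‖f x‖ = 1 := h.self_of_nhds
  simp [hv, h4] at h3

theorem not_exists_contDiff_retraction (f : F → F)
    (hf : ∀ x ∈ closedBall (0 : F) 1, ContDiffAt ℝ 1 f x)
    (hf1 : ∀ x ∈ closedBall (0 : F) 1, ‖f x‖ = 1)
    (hfS : ∀ x ∈ sphere (0 : F) 1, f x = x) : False := by
  borelize F
  let U := ball (0 : F) 1
  let A : F → F →L[ℝ] F := fun x => fderiv ℝ f x - ContinuousLinearMap.id ℝ F
  have hcA : ContinuousOn A (closedBall 0 1) := fun x hx =>
    ((((hf x hx).fderiv_right (m := 0) (by norm_num)).continuousAt).sub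
      continuousAt_const).continuousWithinAt
  have hgd : ∀ x ∈ closedBall (0 : F) 1, HasFDerivAt (fun y => f y - y) (A x) x := fun x hx =>
    (((hf x hx).differentiableAt one_ne_zero).hasFDerivAt).sub (hasFDerivAt_id x)
  obtain ⟨C₀, hC₀⟩ := (isCompact_closedBall (0 : F) 1).exists_bound_of_continuousOn hcA
  let C : NNReal := Real.toNNReal C₀
  have hAC : ∀ x ∈ closedBall (0 : F) 1, ‖A x‖ ≤ C := fun x hx =>
    (hC₀ x hx).trans (Real.le_coe_toNNReal _)
  have hlip : LipschitzOnWith C (fun y => f y - y) (closedBall 0 1) :=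
    (convex_closedBall (0 : F) 1).lipschitzOnWith_of_nnnorm_hasFDerivWithin_le
      (fun x hx => (hgd x hx).hasFDerivWithinAt) fun x hx => by exact_mod_cast hAC x hx
  let g : F → F := U.indicator fun y => f y - y
  have hg : LipschitzWith C g :=
    lipschitzWith_indicator_ball hlip fun x hx => by rw [hfS x hx, sub_self]
  have hvol : ∀ t : ℝ, 0 ≤ t → t * C < 1 →
      ∫ x in U, (ContinuousLinearMap.id ℝ F + t • A x).det = volume.real U := by
    intro t ht htC
    have hbij := bijective_id_add_smul hg ht htC
    have himg : (fun x => x + t • g x) '' U = U := by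
      have hc : (fun x => x + t • g x) '' Uᶜ = Uᶜ := by
        rw [image_congr (g := id) fun x hx => by simp [g, indicator_of_notMem hx], image_id]
      rw [← compl_inj_iff, ← image_compl_eq hbij, hc]
    have hder : ∀ x ∈ U, HasFDerivWithinAt (fun x => x + t • g x)
        (ContinuousLinearMap.id ℝ F + t • A x) U x := by
      intro x hx
      refine HasFDerivWithinAt.congr (f := fun x => x + t • (f x - x)) ?_ (fun y hy => by
        simp [g, indicator_of_mem hy]) (by simp [g, indicator_of_mem hx])
      exact ((hasFDerivAt_id x).add ((hgd x (ball_subset_closedBall hx)).const_smul t)).hasFDerivWithinAt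
    have := integral_image_eq_integral_abs_det_fderiv_smul (volume : Measure F)
      measurableSet_ball hder hbij.1.injOn (fun _ => (1 : ℝ))
    rw [himg, setIntegral_const] at this
    simp only [smul_eq_mul, mul_one] at this
    rw [this]
    refine setIntegral_congr_fun measurableSet_ball fun x hx => ?_
    exact (abs_of_pos (det_id_add_smul_pos (hAC x (ball_subset_closedBall hx)) ht htC)).symm
  have hint : ∀ t : ℝ, IntegrableOn (fun x => (ContinuousLinearMap.id ℝ F + t • A x).det) U := by
    intro t
    refine (ContinuousOn.integrableOn_compact (isCompact_closedBall (0 : F) 1) ?_).mono_set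
      ball_subset_closedBall
    exact ContinuousLinearMap.continuous_det.comp_continuousOn
      (continuousOn_const.add (hcA.const_smul t))
  let s : Finset ℕ := Finset.range (Module.finrank ℝ F + 1)
  let v : ℕ → ℝ := fun i => (((i : ℝ) + 1) * (C + 1))⁻¹
  have hv0 : ∀ i, 0 ≤ v i := fun i => by positivity
  have hvC : ∀ i, v i * C < 1 := fun i => by
    rw [inv_mul_lt_iff₀ (by positivity)]
    have := C.coe_nonneg
    have : (0 : ℝ) ≤ i := by positivity
    nlinarith
  have hvinj : Set.InjOn v s := by
    intro i _ j _ hij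
    have h := inv_injective hij
    have h' := mul_right_cancel₀ (by positivity) h
    exact_mod_cast add_right_cancel h'
  let L : ℕ → ℝ := fun i => (Lagrange.basis s v i).eval 1
  have hL : ∑ i ∈ s, L i = 1 := by
    have := congrArg (Polynomial.eval 1) (Lagrange.sum_basis hvinj ⟨0, by simp [s]⟩)
    simpa [Polynomial.eval_finsetSum] using this
  have hinterp : ∀ x, (ContinuousLinearMap.id ℝ F + (1 : ℝ) • A x).det
      = ∑ i ∈ s, L i * (ContinuousLinearMap.id ℝ F + v i • A x).det := by
    intro x
    obtain ⟨p, hpd, hp⟩ := exists_polynomial_det_id_add_smul (A x)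
    have h := Lagrange.eq_interpolate (f := p) hvinj (by
      refine p.degree_le_natDegree.trans_lt ?_
      simp only [s, Finset.card_range]
      exact_mod_cast Nat.lt_succ_of_le hpd)
    rw [hp, h, Lagrange.interpolate_apply, Polynomial.eval_finsetSum]
    refine Finset.sum_congr rfl fun i _ => ?_
    rw [Polynomial.eval_mul, Polynomial.eval_C, hp, mul_comm]
  have hone : ∫ x in U, (ContinuousLinearMap.id ℝ F + (1 : ℝ) • A x).det = volume.real U := by
    simp_rw [hinterp]
    rw [integral_finsetSum _ fun i _ => (hint (v i)).const_mul _]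
    simp_rw [integral_const_mul]
    rw [Finset.sum_congr rfl fun i _ => by rw [hvol (v i) (hv0 i) (hvC i)], ← Finset.sum_mul, hL,
      one_mul]
  have hzero : ∫ x in U, (ContinuousLinearMap.id ℝ F + (1 : ℝ) • A x).det = 0 := by
    rw [setIntegral_congr_fun (g := fun _ => (0 : ℝ)) measurableSet_ball, integral_zero]
    intro x hx
    have hx' := ball_subset_closedBall hx
    have : ContinuousLinearMap.id ℝ F + (1 : ℝ) • A x = fderiv ℝ f x := by simp [A]
    simp only [this]
    refine det_fderiv_eq_zero_of_norm_eq_one ((hf x hx').differentiableAt one_ne_zero).hasFDerivAt ?_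
    filter_upwards [isOpen_ball.mem_nhds hx] with y hy using hf1 y (ball_subset_closedBall hy)
  have hpos : 0 < volume.real U :=
    ENNReal.toReal_pos (measure_ball_pos _ _ one_pos).ne' measure_ball_lt_top.ne
  rw [hone] at hzero
  exact hpos.ne' hzero

theorem exists_fixedPoint_of_contDiff (f : F → F) (hf : ContDiff ℝ 1 f)
    (hmaps : ∀ x ∈ closedBall (0 : F) 1, ‖f x‖ < 1) : ∃ x ∈ closedBall (0 : F) 1, f x = x := by
  by_contra! hne
  let w : F → F := fun x => x - f x
  let D : F → ℝ := fun x => inner ℝ x (w x) ^ 2 + ‖w x‖ ^ 2 * (1 - ‖x‖ ^ 2)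
  let s : F → ℝ := fun x => (-inner ℝ x (w x) + √(D x)) / ‖w x‖ ^ 2
  have hw : ∀ x ∈ closedBall (0 : F) 1, 0 < ‖w x‖ ^ 2 := fun x hx => by
    have : w x ≠ 0 := sub_ne_zero.2 (hne x hx).symm
    positivity
  have hinner : ∀ x : F, ‖x‖ = 1 → 0 < inner ℝ x (w x) := by
    intro x hx
    have h1 : inner ℝ x (f x) ≤ ‖x‖ * ‖f x‖ := real_inner_le_norm _ _
    have h2 := hmaps x (by simp [hx])
    simp only [w, inner_sub_right, real_inner_self_eq_norm_sq, hx] at *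
    linarith
  have hD : ∀ x ∈ closedBall (0 : F) 1, 0 < D x := by
    intro x hx
    have hx1 : ‖x‖ ≤ 1 := by simpa using hx
    rcases hx1.lt_or_eq with h | h
    · have : 0 < 1 - ‖x‖ ^ 2 := by nlinarith [norm_nonneg x]
      have := mul_pos (hw x hx) this
      simp only [D]
      positivity
    · have := hinner x h
      simp only [D, h]
      positivity
  have hwc : ContDiff ℝ 1 w := contDiff_id.sub hf
  have hDc : ContDiff ℝ 1 D :=
    ((contDiff_id.inner ℝ hwc).pow 2).add ((hwc.norm_sq ℝ).mul
      (contDiff_const.sub (contDiff_id.norm_sq ℝ)))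
  refine not_exists_contDiff_retraction (fun x => x + s x • w x) (fun x hx => ?_) (fun x hx => ?_)
    fun x hx => ?_
  · refine contDiffAt_id.add (ContDiffAt.smul (ContDiffAt.div ?_ (hwc.norm_sq ℝ).contDiffAt
      (hw x hx).ne') hwc.contDiffAt)
    exact (contDiff_id.inner ℝ hwc).contDiffAt.neg.add (hDc.contDiffAt.sqrt (hD x hx).ne')
  · have h1 : ‖x + s x • w x‖ ^ 2 = 1 := by
      rw [norm_add_sq_real, inner_smul_right, norm_smul, mul_pow, Real.norm_eq_abs, sq_abs]
      have hs : s x * ‖w x‖ ^ 2 = -inner ℝ x (w x) + √(D x) := div_mul_cancel₀ _ (hw x hx).ne'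
      have hsq : √(D x) ^ 2 = D x := Real.sq_sqrt (hD x hx).le
      have h2 : (s x * ‖w x‖ ^ 2 + inner ℝ x (w x)) ^ 2 = D x := by rw [hs, neg_add_eq_sub, sub_add_cancel, hsq]
      have h3 : ‖w x‖ ^ 2 * (‖x‖ ^ 2 + 2 * (s x * inner ℝ x (w x)) + s x ^ 2 * ‖w x‖ ^ 2 - 1)
          = 0 := by
        simp only [D] at h2
        linear_combination h2
      have := (mul_eq_zero.1 h3).resolve_left (hw x hx).ne'
      linarith
    exact (pow_eq_one_iff_of_nonneg (norm_nonneg _) two_ne_zero).1 h1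
  · have hx1 : ‖x‖ = 1 := by simpa using hx
    have hDx : D x = inner ℝ x (w x) ^ 2 := by simp [D, hx1]
    have : s x = 0 := by
      simp only [s, hDx, Real.sqrt_sq (hinner x hx1).le, neg_add_cancel, zero_div]
    simp [this]

theorem exists_fixedPoint_unitBall (f : F → F) (hf : ContinuousOn f (closedBall 0 1))
    (hmaps : MapsTo f (closedBall 0 1) (closedBall 0 1)) :
    ∃ x ∈ closedBall (0 : F) 1, f x = x := by
  by_contra! hne
  have hK := isCompact_closedBall (0 : F) 1
  obtain ⟨x₀, hx₀, hmin⟩ := hK.exists_isMinOn ⟨0, by simp⟩ (hf.sub continuousOn_id).norm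
  set ε := ‖f x₀ - x₀‖
  have hε : 0 < ε := norm_pos_iff.2 (sub_ne_zero.2 (hne x₀ hx₀))
  let δ := min (ε / 4) (1 / 4)
  have hδ : 0 < δ := by positivity
  have hδε : δ ≤ ε / 4 := min_le_left _ _
  have hδ1 : δ ≤ 1 / 4 := min_le_right _ _
  obtain ⟨h, hh⟩ := ContinuousMap.exists_restrict_eq isClosed_closedBall
    (⟨(closedBall (0 : F) 1).domRestrict f, hf.domRestrict⟩ : C(closedBall (0 : F) 1, F))
  have hhf : ∀ x ∈ closedBall (0 : F) 1, h x = f x := fun x hx =>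
    DFunLike.congr_fun hh ⟨x, hx⟩
  obtain ⟨g, hg, hgd, -⟩ := Continuous.exists_contDiff_approx 1
    (f := fun x => (1 - 2 * δ) • h x) (h.continuous.const_smul _) (ε := fun _ => δ)
    continuous_const fun _ => hδ
  have hfx : ∀ x ∈ closedBall (0 : F) 1, ‖f x‖ ≤ 1 := fun x hx => by simpa using hmaps hx
  have hgf : ∀ x ∈ closedBall (0 : F) 1, ‖g x - (1 - 2 * δ) • f x‖ < δ := fun x hx => by
    simpa [dist_eq_norm, hhf x hx] using hgd x
  obtain ⟨x, hx, hgx⟩ := exists_fixedPoint_of_contDiff g hg fun x hx => by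
    calc ‖g x‖ = ‖(g x - (1 - 2 * δ) • f x) + (1 - 2 * δ) • f x‖ := by rw [sub_add_cancel]
      _ ≤ ‖g x - (1 - 2 * δ) • f x‖ + ‖(1 - 2 * δ) • f x‖ := norm_add_le _ _
      _ < δ + (1 - 2 * δ) * 1 := by
        rw [norm_smul, Real.norm_of_nonneg (by linarith)]
        have : (1 - 2 * δ) * ‖f x‖ ≤ (1 - 2 * δ) * 1 :=
          mul_le_mul_of_nonneg_left (hfx x hx) (by linarith)
        linarith [hgf x hx]
      _ ≤ 1 := by linarith
  have h1 : ε ≤ ‖f x - x‖ := hmin hx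
  have h2 : f x - x = (2 * δ) • f x - (g x - (1 - 2 * δ) • f x) := by
    rw [hgx]; module
  have h3 : ‖f x - x‖ ≤ ‖(2 * δ) • f x‖ + ‖g x - (1 - 2 * δ) • f x‖ := h2 ▸ norm_sub_le _ _
  rw [norm_smul, Real.norm_of_nonneg (by linarith)] at h3
  have h4 := mul_le_mul_of_nonneg_left (hfx x hx) (by linarith : 0 ≤ 2 * δ)
  linarith [hgf x hx]

/-- The Brouwer fixed point theorem on closed balls. -/
theorem exists_fixedPoint_closedBall {c : F} {r : ℝ} (hr : 0 < r) (f : F → F)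
    (hf : ContinuousOn f (closedBall c r)) (hmaps : MapsTo f (closedBall c r) (closedBall c r)) :
    ∃ x ∈ closedBall c r, f x = x := by
  have hφ : MapsTo (fun x : F => c + r • x) (closedBall 0 1) (closedBall c r) := fun x hx => by
    have hx' : ‖x‖ ≤ 1 := by simpa using hx
    simp only [mem_closedBall, dist_self_add_left, norm_smul, Real.norm_of_nonneg hr.le]
    nlinarith
  obtain ⟨x, hx, hfx⟩ := exists_fixedPoint_unitBall (fun x => r⁻¹ • (f (c + r • x) - c))
    (((hf.comp (by fun_prop) hφ).sub continuousOn_const).const_smul _) fun x hx => by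
      have := hmaps (hφ hx)
      rw [mem_closedBall, dist_eq_norm] at this
      simp only [mem_closedBall_zero_iff, norm_smul, norm_inv, Real.norm_of_nonneg hr.le]
      rwa [inv_mul_le_iff₀ hr, mul_one]
  refine ⟨c + r • x, hφ hx, ?_⟩
  have : r • x = f (c + r • x) - c := by
    conv_lhs => rw [← hfx]
    rw [smul_inv_smul₀ hr.ne']
  exact (add_eq_of_eq_sub' this).symm

/-- No ball embeds in a space of smaller dimension. -/
theorem not_injOn_closedBall_of_finrank_lt {G : Type*} [NormedAddCommGroup G]
    [InnerProductSpace ℝ G] [FiniteDimensional ℝ G]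
    (hdim : Module.finrank ℝ G < Module.finrank ℝ F) {c : F} {r : ℝ} (hr : 0 < r) (f : F → G)
    (hf : ContinuousOn f (closedBall c r)) : ¬ InjOn f (closedBall c r) := by
  intro hinj
  set B := closedBall c r
  have hB : IsCompact B := isCompact_closedBall c r
  have : CompactSpace B := isCompact_iff_compactSpace.1 hB
  have hemb : IsClosedEmbedding (B.domRestrict f) :=
    hf.domRestrict.isClosedEmbedding (injOn_iff_injective.1 hinj)
  obtain ⟨h, hh⟩ := ContinuousMap.exists_extension hemb
    (⟨Subtype.val, continuous_subtype_val⟩ : C(B, F))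
  have hhf : ∀ x ∈ B, h (f x) = x := fun x hx => DFunLike.congr_fun hh ⟨x, hx⟩
  obtain ⟨g, hg, hgd, -⟩ := Continuous.exists_contDiff_approx 1 h.continuous
    (ε := fun _ => r / 2) continuous_const fun _ => half_pos hr
  obtain ⟨y, hy, hyd⟩ := (hg.dense_compl_range_of_finrank_lt_finrank hdim).exists_mem_open
    isOpen_ball ⟨c, mem_ball_self (half_pos hr)⟩
  obtain ⟨x, hx, hfx⟩ := exists_fixedPoint_closedBall hr (fun x => x + (y - g (f x)))
    (continuousOn_id.add (continuousOn_const.sub (hg.continuous.comp_continuousOn hf)))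
    fun x hx => by
      have h1 := hgd (f x)
      rw [hhf x hx] at h1
      rw [mem_ball] at hyd
      simp only [mem_closedBall, dist_eq_norm] at *
      have : x + (y - g (f x)) - c = (y - c) - (g (f x) - x) := by abel
      rw [this]
      linarith [norm_sub_le (y - c) (g (f x) - x)]
  exact hy ⟨f x, (sub_eq_zero.1 (add_eq_left.1 hfx)).symm⟩

end Brouwer

section ClosestPoint

variable {N : ℕ} {A : Set (E N)} {x y z q : E N}

lemma IsClosestPoint.eq (hx : Metric.infEDist x A < reach A) (hy : IsClosestPoint A x y)
    (hz : IsClosestPoint A x z) : y = z := by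
  by_contra hne
  exact hx.not_ge (iInf₂_le x ⟨y, z, hne, hy, hz⟩)

lemma exists_isClosestPoint (hA : IsCompact A) (hne : A.Nonempty) (x : E N) :
    ∃ y, IsClosestPoint A x y := by
  obtain ⟨y, hy, hmin⟩ := hA.exists_isMinOn hne (continuous_const.dist continuous_id).continuousOn
    (f := fun y => dist x y)
  exact ⟨y, hy, fun z hz => hmin hz⟩

lemma isClosestPoint_proj (hA : IsCompact A) (hx : Metric.infEDist x A < reach A) :
    IsClosestPoint A x (proj A x) := by
  have hne : A.Nonempty := by
    by_contra h
    rw [not_nonempty_iff_eq_empty.1 h, Metric.infEDist_empty] at hx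
    exact not_top_lt hx
  have h := exists_isClosestPoint hA hne x
  rw [proj, dif_pos h]
  exact h.choose_spec

lemma IsClosestPoint.proj_eq (hy : IsClosestPoint A x y) (hx : Metric.infEDist x A < reach A) :
    proj A x = y := by
  have h : ∃ y, IsClosestPoint A x y := ⟨y, hy⟩
  rw [proj, dif_pos h]
  exact IsClosestPoint.eq hx h.choose_spec hy

lemma isClosestPoint_self (hx : x ∈ A) : IsClosestPoint A x x :=
  ⟨hx, fun z _ => by rw [dist_self]; exact dist_nonneg⟩

lemma continuousOn_proj (hA : IsCompact A) :
    ContinuousOn (proj A) {x | Metric.infEDist x A < reach A} := by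
  intro x₀ hx₀
  refine hA.tendsto_nhds_of_unique_mapClusterPt (eventually_mem_nhdsWithin.mono fun x hx =>
    (isClosestPoint_proj hA hx).1) fun z hz hcl => ?_
  refine (IsClosestPoint.proj_eq ⟨hz, fun w hw => ?_⟩ hx₀).symm
  obtain ⟨U, hU, hUz⟩ := mapClusterPt_iff_ultrafilter.1 hcl
  have hid : Tendsto id (U : Filter (E N)) (𝓝 x₀) := hU.trans nhdsWithin_le_nhds
  refine le_of_tendsto_of_tendsto (hid.dist hUz) (hid.dist tendsto_const_nhds) ?_
  have : ∀ᶠ x in (U : Filter (E N)), x ∈ {x | Metric.infEDist x A < reach A} :=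
    hU eventually_mem_nhdsWithin
  exact this.mono fun x hx => (isClosestPoint_proj hA hx).2 w hw

lemma IsClosestPoint.of_segment (h : IsClosestPoint A y q) {a : ℝ} (ha0 : 0 ≤ a) (ha1 : a ≤ 1)
    (hx : x = q + a • (y - q)) : IsClosestPoint A x q := by
  refine ⟨h.1, fun z hz => ?_⟩
  have h1 : dist x q = a * dist y q := by
    rw [hx, dist_eq_norm, dist_eq_norm, add_sub_cancel_left, norm_smul, Real.norm_of_nonneg ha0]
  have h2 : dist y x = (1 - a) * dist y q := by
    have : y - x = (1 - a) • (y - q) := by rw [hx]; module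
    rw [dist_eq_norm, dist_eq_norm, this, norm_smul, Real.norm_of_nonneg (by linarith)]
  linarith [h.2 z hz, dist_triangle y x z]

lemma IsClosestPoint.inner_eq_zero {M : Set (E N)} (h : IsClosestPoint M x y) :
    ∀ v ∈ tangentDirection M y, inner ℝ v (x - y) = 0 := by
  suffices tangentDirection M y ≤ (Submodule.span ℝ {x - y})ᗮ from fun v hv =>
    (Submodule.mem_orthogonal' _ _).1 (this hv) _ (Submodule.mem_span_singleton_self _)
  refine Submodule.span_le.2 ?_
  rintro v ⟨γ, hγ0, hγM, hγ⟩
  rw [SetLike.mem_coe, Submodule.mem_orthogonal_singleton_iff_inner_left]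
  have hd : HasDerivAt (fun t => ‖x - γ t‖ ^ 2) (2 * inner ℝ (x - γ 0) (-v)) 0 := by
    simpa using ((hasDerivAt_const (0 : ℝ) x).sub hγ).norm_sq
  have hmin : IsLocalMin (fun t => ‖x - γ t‖ ^ 2) 0 := by
    filter_upwards [hγM] with t ht
    have := h.2 _ ht
    rw [dist_eq_norm, dist_eq_norm] at this
    rw [hγ0]
    gcongr
  have := hmin.hasDerivAt_eq_zero hd
  rw [hγ0, inner_neg_right] at this
  rw [real_inner_comm]
  linarith

lemma tangentProj_eq_iff {M : Set (E N)} {m : E N} :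
    tangentProj M m x = m ↔ ∀ v ∈ tangentDirection M m, inner ℝ v (x - m) = 0 := by
  rw [tangentProj, add_eq_left, Submodule.starProjection_apply_eq_zero_iff,
    Submodule.mem_orthogonal]

end ClosestPoint

section Submanifold

lemma exists_norm_sub_sub_fderiv_le {F G : Type*} [NormedAddCommGroup F] [NormedSpace ℝ F]
    [NormedAddCommGroup G] [NormedSpace ℝ G] {f : F → G} {x : F} (hf : ContDiffAt ℝ 2 f x) :
    ∃ K : ℝ, 0 ≤ K ∧ ∀ᶠ y in 𝓝 x, ‖f y - f x - fderiv ℝ f x (y - x)‖ ≤ K * ‖y - x‖ ^ 2 := by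
  obtain ⟨K, s, hs, hK⟩ := (hf.fderiv_right (m := 1) (by norm_num)).exists_lipschitzOnWith
  have hd : ∀ᶠ y in 𝓝 x, DifferentiableAt ℝ f y :=
    (hf.eventually (by simp)).mono fun y hy => hy.differentiableAt (by simp)
  obtain ⟨ε, hε, hball⟩ := Metric.mem_nhds_iff.1 (inter_mem hs hd)
  refine ⟨K, K.coe_nonneg, ?_⟩
  filter_upwards [Metric.ball_mem_nhds x hε] with y hy
  have hsub : Metric.closedBall x ‖y - x‖ ⊆ Metric.ball x ε :=
    Metric.closedBall_subset_ball (by rwa [← dist_eq_norm])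
  have := (convex_closedBall x ‖y - x‖).norm_image_sub_le_of_norm_hasFDerivWithin_le'
    (f := f) (f' := fderiv ℝ f) (φ := fderiv ℝ f x) (C := K * ‖y - x‖)
    (fun z hz => (hball (hsub hz)).2.hasFDerivAt.hasFDerivWithinAt)
    (fun z hz => by
      have h1 := hK.dist_le_mul z (hball (hsub hz)).1 x (mem_of_mem_nhds hs)
      rw [dist_eq_norm] at h1
      refine h1.trans ?_
      gcongr
      exact hz)
    (Metric.mem_closedBall_self (norm_nonneg _)) (y := y) (by simp [dist_eq_norm])
  refine this.trans_eq ?_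
  ring

variable {N d : ℕ} {M : Set (E N)} {m : E N}

lemma IsC2Submanifold.exists_tangent_approx (hM : IsC2Submanifold d M) (hm : m ∈ M) :
    ∃ K : ℝ, 0 ≤ K ∧ ∀ᶠ z in 𝓝[M] m, ∃ w ∈ tangentDirection M m,
      ‖z - m - w‖ ≤ K * ‖z - m‖ ^ 2 := by
  obtain ⟨Φ, hmΦ, hΦ, hΨ, hΦM⟩ := hM m hm
  have hΨ2 : ContDiffAt ℝ 2 Φ.symm (Φ m) :=
    (hΨ _ (Φ.map_source hmΦ)).contDiffAt (Φ.open_target.mem_nhds (Φ.map_source hmΦ))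
  have hΦ2 : ContDiffAt ℝ 2 Φ m := (hΦ _ hmΦ).contDiffAt (Φ.open_source.mem_nhds hmΦ)
  obtain ⟨K, hK, hev⟩ := exists_norm_sub_sub_fderiv_le hΨ2
  obtain ⟨L, s, hs, hL⟩ := (hΦ2.of_le (m := 1) (by norm_num)).exists_lipschitzOnWith
  refine ⟨K * L ^ 2, by positivity, ?_⟩
  filter_upwards [self_mem_nhdsWithin, nhdsWithin_le_nhds (Φ.open_source.mem_nhds hmΦ),
    nhdsWithin_le_nhds (hΦ2.continuousAt.eventually hev), nhdsWithin_le_nhds hs]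
    with z hzM hz hzK hzs
  refine ⟨fderiv ℝ Φ.symm (Φ m) (Φ z - Φ m), Submodule.subset_span
    ⟨fun t => Φ.symm (Φ m + t • (Φ z - Φ m)), ?_, ?_, ?_⟩, ?_⟩
  · simp [Φ.left_inv hmΦ]
  · have hc : Tendsto (fun t : ℝ => Φ m + t • (Φ z - Φ m)) (𝓝 0) (𝓝 (Φ m)) := by
      have : Continuous fun t : ℝ => Φ m + t • (Φ z - Φ m) := by fun_prop
      simpa using this.tendsto 0
    filter_upwards [hc (Φ.open_target.mem_nhds (Φ.map_source hmΦ))] with t ht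
    rw [hΦM _ (Φ.map_target ht), Φ.right_inv ht]
    intro i hi
    simp [(hΦM m hmΦ).1 hm i hi, (hΦM z hz).1 hzM i hi]
  · have h1 : HasDerivAt (fun t : ℝ => Φ m + t • (Φ z - Φ m)) (Φ z - Φ m) 0 := by
      simpa using ((hasDerivAt_id (0 : ℝ)).smul_const (Φ z - Φ m)).const_add (Φ m)
    have h2 : HasFDerivAt Φ.symm (fderiv ℝ Φ.symm (Φ m)) (Φ m + (0 : ℝ) • (Φ z - Φ m)) := by
      simpa using (hΨ2.differentiableAt (by simp)).hasFDerivAt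
    exact h2.comp_hasDerivAt 0 h1
  · rw [Φ.left_inv hmΦ, Φ.left_inv hz] at hzK
    refine hzK.trans ?_
    have h1 := hL.norm_sub_le hzs (mem_of_mem_nhds hs)
    calc K * ‖Φ z - Φ m‖ ^ 2 ≤ K * (L * ‖z - m‖) ^ 2 := by gcongr
      _ = K * L ^ 2 * ‖z - m‖ ^ 2 := by ring

lemma IsC2Submanifold.exists_isClosestPoint_add_smul (hM : IsC2Submanifold d M) (hm : m ∈ M)
    {v : E N} (hv : ∀ w ∈ tangentDirection M m, inner ℝ w v = 0) :
    ∃ t : ℝ, 0 < t ∧ IsClosestPoint M (m + t • v) m := by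
  obtain ⟨K, hK, hev⟩ := hM.exists_tangent_approx hm
  obtain ⟨δ, hδ, hball⟩ := Metric.mem_nhdsWithin_iff.1 hev
  let t := min (2 * (K * ‖v‖ + 1))⁻¹ (δ / (2 * (‖v‖ + 1)))
  have ht : 0 < t := by positivity
  have ht1 : t * (K * ‖v‖) ≤ 1 / 2 := by
    have h1 : t * (2 * (K * ‖v‖ + 1)) ≤ 1 := by
      have := mul_le_mul_of_nonneg_right (min_le_left _ _ : t ≤ _)
        (by positivity : 0 ≤ 2 * (K * ‖v‖ + 1))
      rwa [inv_mul_cancel₀ (by positivity)] at this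
    linarith
  have ht2 : 2 * (t * ‖v‖) ≤ δ := by
    have h1 : t * (2 * (‖v‖ + 1)) ≤ δ := by
      have := mul_le_mul_of_nonneg_right (min_le_right _ _ : t ≤ _)
        (by positivity : 0 ≤ 2 * (‖v‖ + 1))
      rwa [div_mul_cancel₀ _ (by positivity)] at this
    linarith
  refine ⟨t, ht, hm, fun z hz => ?_⟩
  have hd : dist (m + t • v) m = t * ‖v‖ := by
    rw [dist_self_add_left, norm_smul, Real.norm_of_nonneg ht.le]
  rcases lt_or_ge (dist z m) δ with h | h
  · obtain ⟨w, hw, hzw⟩ := hball ⟨h, hz⟩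
    have h1 : inner ℝ (z - m) v ≤ K * ‖z - m‖ ^ 2 * ‖v‖ := by
      have : inner ℝ (z - m) v = inner ℝ (z - m - w) v := by
        rw [inner_sub_left (z - m), hv w hw, sub_zero]
      rw [this]
      exact (real_inner_le_norm _ _).trans (by gcongr)
    have h2 : ‖(z - m) - t • v‖ ^ 2 = ‖z - m‖ ^ 2 - 2 * (t * inner ℝ (z - m) v) + (t * ‖v‖) ^ 2 := by
      rw [norm_sub_sq_real, inner_smul_right, norm_smul, Real.norm_of_nonneg ht.le]
    have h3 : t * inner ℝ (z - m) v ≤ 1 / 2 * ‖z - m‖ ^ 2 := by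
      calc t * inner ℝ (z - m) v ≤ t * (K * ‖z - m‖ ^ 2 * ‖v‖) := by gcongr
        _ = t * (K * ‖v‖) * ‖z - m‖ ^ 2 := by ring
        _ ≤ _ := by gcongr
    rw [hd, dist_comm, dist_eq_norm, ← sub_sub]
    exact abs_le_of_sq_le_sq' (by linarith) (norm_nonneg _) |>.2
  · have := dist_triangle z (m + t • v) m
    rw [hd] at this ⊢
    rw [dist_comm]
    linarith

/-- A normal vector shorter than the reach projects back to its foot. -/
theorem IsC2Submanifold.isClosestPoint_add (hM : IsC2Submanifold d M) (hMc : IsCompact M)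
    (hm : m ∈ M) {v : E N} (hv : ∀ w ∈ tangentDirection M m, inner ℝ w v = 0)
    (hvr : ENNReal.ofReal ‖v‖ < reach M) : IsClosestPoint M (m + v) m := by
  rcases eq_or_ne v 0 with rfl | hv0
  · rw [add_zero]; exact isClosestPoint_self hm
  have hvpos : 0 < ‖v‖ := norm_pos_iff.2 hv0
  let T : Set ℝ := {t | t ∈ Icc 0 1 ∧ IsClosestPoint M (m + t • v) m}
  have hTclosed : IsClosed T := by
    have : T = Icc 0 1 ∩ ⋂ z ∈ M, {t : ℝ | dist (m + t • v) m ≤ dist (m + t • v) z} := by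
      ext t
      simp [T, IsClosestPoint, hm]
    rw [this]
    exact isClosed_Icc.inter (isClosed_biInter fun z _ => isClosed_le (by fun_prop) (by fun_prop))
  have hTc : IsCompact T := isCompact_Icc.of_isClosed_subset hTclosed fun t ht => ht.1
  have hmono : ∀ t : ℝ, IsClosestPoint M (m + t • v) m → ∀ s : ℝ, 0 ≤ s → s ≤ t → 0 < t →
      IsClosestPoint M (m + s • v) m := by
    intro t ht s hs hst htpos
    refine ht.of_segment (div_nonneg hs htpos.le) ((div_le_one htpos).2 hst) ?_
    rw [add_sub_cancel_left, smul_smul, div_mul_cancel₀ _ htpos.ne']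
  obtain ⟨t₁, ht₁, hc₁⟩ := hM.exists_isClosestPoint_add_smul hm hv
  have hT₁ : min t₁ 1 ∈ T := ⟨⟨by positivity, min_le_right _ _⟩,
    hmono t₁ hc₁ _ (by positivity) (min_le_left _ _) ht₁⟩
  obtain ⟨t, htT, htmax⟩ := hTc.exists_isMaxOn ⟨_, hT₁⟩ continuousOn_id
  have htpos : 0 < t := (lt_min ht₁ one_pos).trans_le (htmax hT₁)
  rcases htT.1.2.eq_or_lt with rfl | ht1
  · simpa using htT.2
  exfalso
  set x := m + t • v
  have hxm : dist x m = t * ‖v‖ := by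
    rw [dist_self_add_left, norm_smul, Real.norm_of_nonneg htpos.le]
  let s := min (t * ‖v‖ / 2) ((1 - t) * ‖v‖ / 2)
  have hs : 0 < s := by
    have : 0 < 1 - t := by linarith
    positivity
  have hs1 : s ≤ t * ‖v‖ / 2 := min_le_left _ _
  have hs2 : s < (1 - t) * ‖v‖ := lt_of_le_of_lt (min_le_right _ _) (by
    have : 0 < 1 - t := by linarith
    have := mul_pos this hvpos
    linarith)
  have hreach : ∀ y ∈ Metric.closedBall x s, Metric.infEDist y M < reach M := by
    intro y hy
    refine lt_of_le_of_lt (Metric.infEDist_le_edist_of_mem hm) (lt_of_le_of_lt ?_ hvr)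
    rw [edist_dist]
    refine ENNReal.ofReal_le_ofReal ?_
    have := dist_triangle y x m
    rw [Metric.mem_closedBall] at hy
    linarith
  have hcl : ∀ y ∈ Metric.closedBall x s, IsClosestPoint M y (proj M y) := fun y hy =>
    isClosestPoint_proj hMc (hreach y hy)
  have hdist : ∀ y ∈ Metric.closedBall x s, s ≤ dist y (proj M y) := by
    intro y hy
    have h1 := htT.2.2 _ (hcl y hy).1
    have h2 := dist_triangle x y (proj M y)
    rw [Metric.mem_closedBall, dist_comm] at hy
    change dist x m ≤ dist x _ at h1
    linarith
  have hD : ∀ y ∈ Metric.closedBall x s, 0 < ‖y - proj M y‖ := fun y hy => by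
    rw [← dist_eq_norm]; exact hs.trans_le (hdist y hy)
  have hpc : ContinuousOn (fun y => y - proj M y) (Metric.closedBall x s) :=
    continuousOn_id.sub ((continuousOn_proj hMc).mono hreach)
  obtain ⟨y, hy, hfix⟩ := exists_fixedPoint_closedBall hs
    (fun y => x + (s / ‖y - proj M y‖) • (y - proj M y))
    (continuousOn_const.add ((continuousOn_const.div hpc.norm fun y hy => (hD y hy).ne').smul hpc))
    fun y hy => by
      rw [Metric.mem_closedBall, dist_self_add_left, norm_smul, Real.norm_of_nonneg (by positivity),
        div_mul_cancel₀ _ (hD y hy).ne']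
  set q := proj M y
  set D := ‖y - q‖
  have hDpos : 0 < D := hD y hy
  have hsD : s ≤ D := (hdist y hy).trans_eq (dist_eq_norm _ _)
  have hx : x = q + (1 - s / D) • (y - q) := by
    have : x = y - (s / D) • (y - q) := eq_sub_of_add_eq hfix
    rw [this]; module
  have hqm : q = m := IsClosestPoint.eq (hreach x (Metric.mem_closedBall_self hs.le))
    ((hcl y hy).of_segment (sub_nonneg.2 ((div_le_one hDpos).2 hsD))
      (sub_le_self _ (by positivity)) hx) htT.2
  have hDx : D = t * ‖v‖ + s := by
    have h1 : dist x q = (1 - s / D) * D := by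
      rw [hx, dist_self_add_left, norm_smul, Real.norm_of_nonneg
        (sub_nonneg.2 ((div_le_one hDpos).2 hsD))]
    rw [hqm, hxm, sub_mul, one_mul, div_mul_cancel₀ _ hDpos.ne'] at h1
    linarith
  have hsD' : 0 < 1 - s / D := by
    rw [sub_pos, div_lt_one hDpos]
    have := mul_pos htpos hvpos
    linarith
  have hy' : y = m + (t / (1 - s / D)) • v := by
    have h1 : t • v = (1 - s / D) • (y - m) := by
      have : m + t • v = m + (1 - s / D) • (y - m) := by rw [← hqm]; rw [← hx, hqm]
      exact add_left_cancel this
    rw [div_eq_inv_mul, ← smul_smul, h1, inv_smul_smul₀ hsD'.ne', add_sub_cancel]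
  have hnew : t / (1 - s / D) ∈ T := by
    refine ⟨⟨by positivity, ?_⟩, ?_⟩
    · have h1 : t / (1 - s / D) * ‖v‖ = D := by
        have : D = ‖y - m‖ := by rw [← hqm]
        have h2 : ‖y - m‖ = t / (1 - s / D) * ‖v‖ := by
          conv_lhs => rw [hy', add_sub_cancel_left, norm_smul, Real.norm_of_nonneg (by positivity)]
        rw [← h2, this]
      by_contra! hlt
      nlinarith
    · rw [← hy', ← hqm]
      exact hcl y hy
  have h1 : t / (1 - s / D) ≤ t := htmax hnew
  rw [div_le_iff₀ hsD'] at h1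
  have : 0 < t * (s / D) := by positivity
  linarith

/-- A point near `m` in the normal space at `m` projects to `m`. -/
theorem IsC2Submanifold.proj_eq_of_tangentProj_eq (hM : IsC2Submanifold d M) (hMc : IsCompact M)
    (hm : m ∈ M) {x : E N} {r : ℝ} (hr : ENNReal.ofReal r < reach M) (hxm : dist x m ≤ r)
    (hx : tangentProj M m x = m) : proj M x = m := by
  have hd : edist x m < reach M := by
    rw [edist_dist]
    exact (ENNReal.ofReal_le_ofReal hxm).trans_lt hr
  have := hM.isClosestPoint_add hMc hm (tangentProj_eq_iff.1 hx)
    (by rwa [← dist_eq_norm, ← edist_dist])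
  rw [add_sub_cancel] at this
  exact this.proj_eq ((Metric.infEDist_le_edist_of_mem hm).trans_lt hd)

end Submanifold

/-- Weak invariance of dimension: an open set does not inject continuously in smaller dimension. -/
theorem finrank_le_of_continuous_injective {F G : Type*} [NormedAddCommGroup F]
    [InnerProductSpace ℝ F] [FiniteDimensional ℝ F] [NormedAddCommGroup G] [InnerProductSpace ℝ G]
    [FiniteDimensional ℝ G] {O : Set F} (hO : IsOpen O) (hne : O.Nonempty) (f : O → G)
    (hf : Continuous f) (hinj : Function.Injective f) :
    Module.finrank ℝ F ≤ Module.finrank ℝ G := by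
  classical
  by_contra! hlt
  obtain ⟨c, hc⟩ := hne
  obtain ⟨r, hr, hball⟩ := Metric.nhds_basis_closedBall.mem_iff.1 (hO.mem_nhds hc)
  let g : F → G := fun x => if h : x ∈ O then f ⟨x, h⟩ else 0
  have hg : O.domRestrict g = f := by
    ext1 ⟨x, hx⟩
    simp [g, hx]
  refine not_injOn_closedBall_of_finrank_lt hlt (c := c) hr g ?_ ?_
  · exact (continuousOn_iff_continuous_domRestrict.2 (hg ▸ hf)).mono hball
  · exact (injOn_iff_injective.2 (hg ▸ hinj)).mono hball

section Barycentric

variable {N : ℕ} {σ τ : Finset (E N)} {x y : E N}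

/-- `ℓ` is a family of affine functions dual to the points of `σ`. -/
def IsBarycentric (σ : Finset (E N)) (ℓ : E N → E N →ᵃ[ℝ] ℝ) : Prop :=
  ∀ v ∈ σ, ℓ v v = 1 ∧ ∀ u ∈ σ, u ≠ v → ℓ v u = 0

lemma exists_isBarycentric (hσ : AffineIndependent ℝ ((↑) : σ → E N)) :
    ∃ ℓ, IsBarycentric σ ℓ := by
  classical
  obtain ⟨t, hst, hti, htop⟩ := exists_subset_affineIndependent_affineSpan_eq_top
    (s := (σ : Set (E N))) hσ
  let b : AffineBasis t ℝ (E N) := ⟨Subtype.val, hti, by rwa [Subtype.range_coe]⟩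
  refine ⟨fun v => if h : v ∈ t then b.coord ⟨v, h⟩ else 0, fun v hv => ?_⟩
  have hvt : v ∈ t := hst hv
  simp only [dif_pos hvt]
  refine ⟨b.coord_apply_eq ⟨v, hvt⟩, fun u hu huv => ?_⟩
  exact b.coord_apply_ne (i := ⟨v, hvt⟩) (j := ⟨u, hst hu⟩) fun h => huv (congrArg Subtype.val h).symm

namespace IsBarycentric

variable {ℓ : E N → E N →ᵃ[ℝ] ℝ}

lemma mono (h : IsBarycentric σ ℓ) (hτ : τ ⊆ σ) : IsBarycentric τ ℓ :=
  fun v hv => ⟨(h v (hτ hv)).1, fun u hu => (h v (hτ hv)).2 u (hτ hu)⟩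

lemma sum_eq (h : IsBarycentric σ ℓ) (hy : y ∈ affineSpan ℝ (σ : Set (E N))) :
    ∑ v ∈ σ, ℓ v y = 1 ∧ ∑ v ∈ σ, ℓ v y • v = y := by
  refine affineSpan_induction (p := fun y => ∑ v ∈ σ, ℓ v y = 1 ∧ ∑ v ∈ σ, ℓ v y • v = y) hy
    (fun u hu => ?_) fun c u v w hu hv hw => ?_
  · have h1 : ∀ v ∈ σ, v ≠ u → ℓ v u = 0 := fun v hv hvu => (h v hv).2 u hu hvu.symm
    constructor
    · rw [Finset.sum_eq_single_of_mem u hu h1, (h u hu).1]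
    · rw [Finset.sum_eq_single_of_mem u hu fun v hv hvu => by rw [h1 v hv hvu, zero_smul],
        (h u hu).1, one_smul]
  · have key : ∀ a, ℓ a (c • (u -ᵥ v) +ᵥ w) = c * (ℓ a u - ℓ a v) + ℓ a w := by
      intro a
      rw [AffineMap.map_vadd, map_smul, AffineMap.linearMap_vsub]
      simp
    simp only [key]
    constructor
    · rw [Finset.sum_add_distrib, ← Finset.mul_sum, Finset.sum_sub_distrib, hu.1, hv.1, hw.1]
      ring
    · simp only [add_smul, mul_smul, sub_smul]
      rw [Finset.sum_add_distrib, ← Finset.smul_sum, Finset.sum_sub_distrib, hu.2, hv.2, hw.2]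
      rfl

lemma mem_conv (h : IsBarycentric σ ℓ) (hy : y ∈ affineSpan ℝ (σ : Set (E N)))
    (h0 : ∀ v ∈ σ, 0 ≤ ℓ v y) : y ∈ conv σ :=
  Finset.mem_convexHull'.2 ⟨fun v => ℓ v y, h0, (h.sum_eq hy).1, (h.sum_eq hy).2⟩

lemma nonneg (h : IsBarycentric σ ℓ) (hy : y ∈ conv σ) {v : E N} (hv : v ∈ σ) : 0 ≤ ℓ v y := by
  have hsub : conv σ ⊆ ℓ v ⁻¹' Ici 0 := convexHull_min (fun u hu => by
    rcases eq_or_ne u v with rfl | huv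
    · simp [(h u hv).1]
    · simp [(h v hv).2 u hu huv]) ((convex_Ici 0).affine_preimage (ℓ v))
  exact hsub hy

lemma eq_zero (h : IsBarycentric σ ℓ) {t : Set (E N)} (ht : t ⊆ σ) (hy : y ∈ convexHull ℝ t)
    {v : E N} (hv : v ∈ σ) (hvt : v ∉ t) : ℓ v y = 0 := by
  have hsub : convexHull ℝ t ⊆ ℓ v ⁻¹' {0} := convexHull_min (fun u hu =>
    (h v hv).2 u (ht hu) fun huv => hvt (huv ▸ hu)) ((convex_singleton 0).affine_preimage (ℓ v))
  exact hsub hy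

lemma continuous (ℓ : E N →ᵃ[ℝ] ℝ) : Continuous ℓ :=
  AffineMap.continuous_of_finiteDimensional ℓ

lemma isOpen_pos (σ : Finset (E N)) (ℓ : E N → E N →ᵃ[ℝ] ℝ) :
    IsOpen {y | ∀ v ∈ σ, 0 < ℓ v y} := by
  have : {y | ∀ v ∈ σ, 0 < ℓ v y} = ⋂ v ∈ σ, {y | 0 < ℓ v y} := by ext; simp
  rw [this]
  exact isOpen_biInter_finset fun v _ => isOpen_lt continuous_const (continuous (ℓ v))

lemma mem_intrinsicInterior (h : IsBarycentric σ ℓ) (hy : y ∈ affineSpan ℝ (σ : Set (E N)))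
    (h0 : ∀ v ∈ σ, 0 < ℓ v y) : y ∈ intrinsicInterior ℝ (conv σ) := by
  rw [_root_.mem_intrinsicInterior]
  have hspan : affineSpan ℝ (conv σ) = affineSpan ℝ (σ : Set (E N)) := affineSpan_convexHull _
  refine ⟨⟨y, hspan ▸ hy⟩, mem_interior.2 ⟨Subtype.val ⁻¹' {y | ∀ v ∈ σ, 0 < ℓ v y}, ?_,
    (isOpen_pos σ ℓ).preimage continuous_subtype_val, h0⟩, rfl⟩
  rintro ⟨z, hz⟩ hz0
  exact h.mem_conv (hspan ▸ hz) fun v hv => (hz0 v hv).le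

lemma exists_pos (h : IsBarycentric σ ℓ) (hne : σ.Nonempty) :
    ∃ c ∈ conv σ, ∀ v ∈ σ, 0 < ℓ v c := by
  have hn : (0 : ℝ) < σ.card := by exact_mod_cast hne.card_pos
  let c := ∑ u ∈ σ, (σ.card : ℝ)⁻¹ • u
  have hsum : ∑ _u ∈ σ, (σ.card : ℝ)⁻¹ = 1 := by
    rw [Finset.sum_const, nsmul_eq_mul, mul_inv_cancel₀ hn.ne']
  refine ⟨c, Finset.mem_convexHull'.2 ⟨fun _ => (σ.card : ℝ)⁻¹, fun _ _ => by positivity, hsum, rfl⟩,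
    fun v hv => ?_⟩
  have h1 : ℓ v c = ∑ u ∈ σ, (σ.card : ℝ)⁻¹ * ℓ v u := by
    have hdec : ∀ y, ℓ v y = (ℓ v).linear y + ℓ v 0 := fun y => congrFun (ℓ v).decomp y
    have hterm : ∀ u ∈ σ, (σ.card : ℝ)⁻¹ * ℓ v u
        = (ℓ v).linear ((σ.card : ℝ)⁻¹ • u) + (σ.card : ℝ)⁻¹ * ℓ v 0 := fun u _ => by
      rw [hdec u, map_smul, smul_eq_mul, mul_add]
    rw [hdec c, Finset.sum_congr rfl hterm, Finset.sum_add_distrib, ← Finset.sum_mul, hsum, one_mul,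
      map_sum]
  rw [h1, Finset.sum_eq_single_of_mem v hv fun u hu huv => by rw [(h v hv).2 u hu huv, mul_zero],
    (h v hv).1]
  positivity

end IsBarycentric

lemma conv_subset_affineSpan : conv σ ⊆ affineSpan ℝ (σ : Set (E N)) :=
  convexHull_subset_affineSpan (𝕜 := ℝ) _

lemma isCompact_conv : IsCompact (conv σ) := σ.finite_toSet.isCompact_convexHull (𝕜 := ℝ)

lemma nonempty_of_mem_conv (hx : x ∈ conv σ) : σ.Nonempty := by
  have : (conv σ).Nonempty := ⟨x, hx⟩
  simpa [conv] using this

/-- Every point of a simplex lies in the relative interior of one of its faces. -/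
lemma exists_mem_intrinsicInterior (hσ : AffineIndependent ℝ ((↑) : σ → E N)) (hx : x ∈ conv σ) :
    ∃ τ ⊆ σ, τ.Nonempty ∧ x ∈ intrinsicInterior ℝ (conv τ) := by
  classical
  obtain ⟨ℓ, hℓ⟩ := exists_isBarycentric hσ
  let τ := σ.filter fun v => 0 < ℓ v x
  have hτ : τ ⊆ σ := Finset.filter_subset _ _
  have hz : ∀ v ∈ σ, v ∉ τ → ℓ v x = 0 := fun v hv hvτ =>
    le_antisymm (not_lt.1 fun h => hvτ (Finset.mem_filter.2 ⟨hv, h⟩)) (hℓ.nonneg hx hv)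
  have hs := hℓ.sum_eq (conv_subset_affineSpan hx)
  have hxτ : x ∈ conv τ := by
    refine Finset.mem_convexHull'.2 ⟨fun v => ℓ v x, fun v hv => hℓ.nonneg hx (hτ hv), ?_, ?_⟩
    · rw [← hs.1]
      exact Finset.sum_subset hτ hz
    · conv_rhs => rw [← hs.2]
      exact Finset.sum_subset hτ fun v hv hvτ => by simp only [hz v hv hvτ, zero_smul]
  exact ⟨τ, hτ, nonempty_of_mem_conv hxτ, (hℓ.mono hτ).mem_intrinsicInterior
    (conv_subset_affineSpan hxτ) fun v hv => (Finset.mem_filter.1 hv).2⟩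

lemma shadow_eq_biUnion_conv {K : Set (Finset (E N))} (hK : IsSimplicialComplex K)
    (hreal : IsGeometricallyRealized K) : shadow K = ⋃ σ ∈ K, conv σ := by
  refine Subset.antisymm (iUnion₂_mono fun σ _ => intrinsicInterior_subset) ?_
  refine iUnion₂_subset fun σ hσ x hx => ?_
  obtain ⟨τ, hτσ, hne, hxτ⟩ := exists_mem_intrinsicInterior (hreal.nondegenerate σ hσ) hx
  exact mem_iUnion₂.2 ⟨τ, (hK σ hσ).2 τ hτσ hne, hxτ⟩

end Barycentric

section Purity

variable {N d : ℕ} {K : Set (Finset (E N))} {m : E N} {σ τ : Finset (E N)}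

/-- Arbitrarily near `m`, a maximal simplex around `m` has points, with positive barycentric
coordinates, that no other simplex contains. -/
lemma IsGeometricallyRealized.exists_generic_point (hK : IsGeometricallyRealized K)
    (hτ : Maximal (· ∈ K) τ) (hm : m ∈ conv τ) {ℓ : E N → E N →ᵃ[ℝ] ℝ} (hℓ : IsBarycentric τ ℓ)
    {U : Set (E N)} (hU : IsOpen U) (hmU : m ∈ U) :
    ∃ x ∈ conv τ, x ∈ U ∧ (∀ v ∈ τ, 0 < ℓ v x) ∧ ∀ β ∈ K, β ≠ τ → x ∉ conv β := by
  obtain ⟨c, hc, hcpos⟩ := hℓ.exists_pos (nonempty_of_mem_conv hm)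
  have htend : Tendsto (AffineMap.lineMap m c : ℝ → E N) (𝓝[>] 0) (𝓝 m) := by
    have h := (AffineMap.lineMap_continuous (R := ℝ) (p := m) (q := c)).tendsto 0
    rw [AffineMap.lineMap_apply_zero] at h
    exact h.mono_left nhdsWithin_le_nhds
  obtain ⟨t, htU, ht0, ht1⟩ := ((htend.eventually (hU.mem_nhds hmU)).and
    (Ioo_mem_nhdsGT (zero_lt_one (α := ℝ)))).exists
  set x := AffineMap.lineMap m c t
  have hx : x ∈ conv τ := (convex_convexHull ℝ _).lineMap_mem hm hc ⟨ht0.le, ht1.le⟩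
  have hpos : ∀ v ∈ τ, 0 < ℓ v x := by
    intro v hv
    rw [AffineMap.apply_lineMap, AffineMap.lineMap_apply_module]
    have h1 := hℓ.nonneg hm hv
    have h2 := hcpos v hv
    have h3 : 0 ≤ 1 - t := by linarith
    simp only [smul_eq_mul]
    positivity
  refine ⟨x, hx, htU, hpos, fun β hβ hne hxβ => ?_⟩
  have hsub : ¬ τ ⊆ β := fun h => hne ((hτ.eq_of_le hβ h).symm)
  obtain ⟨v, hvτ, hvβ⟩ := Finset.not_subset.1 hsub
  have hint : x ∈ convexHull ℝ ((τ : Set (E N)) ∩ β) := by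
    rw [hK.inter τ hτ.prop β hβ]
    exact ⟨hx, hxβ⟩
  exact (hpos v hvτ).ne' (hℓ.eq_zero inter_subset_left hint hvτ fun h => hvβ h.2)

lemma IsGeometricallyRealized.card_of_maximal (hfin : K.Finite) (hK : IsGeometricallyRealized K)
    (hloc : IsLocallyEuclideanAt d (shadow K) m) (hτ : Maximal (· ∈ K) τ) (hm : m ∈ conv τ) :
    τ.card = d + 1 := by
  obtain ⟨ℓ, hℓ⟩ := exists_isBarycentric (hK.nondegenerate τ hτ.prop)
  obtain ⟨-, U, hU, hmU, ⟨e⟩⟩ := hloc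
  obtain ⟨x, hxτ, hxU, hxpos, hxβ⟩ := hK.exists_generic_point hτ hm hℓ hU hmU
  set S := affineSpan ℝ (τ : Set (E N))
  have hxS : x ∈ S := conv_subset_affineSpan hxτ
  have hrel : ∀ y ∈ S, (∀ v ∈ τ, 0 < ℓ v y) → y ∈ shadow K := fun y hy h =>
    mem_iUnion₂.2 ⟨τ, hτ.prop, hℓ.mem_intrinsicInterior hy h⟩
  let D := S.direction
  have hD : Module.finrank ℝ D + 1 = τ.card := by
    have h := (hK.nondegenerate τ hτ.prop).finrank_vectorSpan (n := τ.card - 1) (by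
      rw [Fintype.card_coe]
      exact (Nat.sub_add_cancel (nonempty_of_mem_conv hm).card_pos).symm)
    have hr : Set.range ((↑) : τ → E N) = (τ : Set (E N)) := Subtype.range_coe
    rw [hr, ← direction_affineSpan] at h
    change Module.finrank ℝ S.direction = _ at h
    have := (nonempty_of_mem_conv hm).card_pos
    change Module.finrank ℝ S.direction + 1 = _
    omega
  have hle : Module.finrank ℝ D ≤ d := by
    let O : Set D := (fun u : D => (u : E N) + x) ⁻¹' (U ∩ {y | ∀ v ∈ τ, 0 < ℓ v y})
    have hO : IsOpen O := (hU.inter (IsBarycentric.isOpen_pos τ ℓ)).preimage (by fun_prop)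
    have hmem : ∀ u : O, ((u : D) : E N) + x ∈ shadow K ∩ U := fun u =>
      ⟨hrel _ (AffineSubspace.vadd_mem_of_mem_direction (u : D).2 hxS) u.2.2, u.2.1⟩
    have := finrank_le_of_continuous_injective hO ⟨0, by simpa [O] using ⟨hxU, hxpos⟩⟩
      (fun u : O => e ⟨_, hmem u⟩)
      (e.continuous.comp (Continuous.subtype_mk (by fun_prop) _)) (fun u v huv => by
        have h1 := congrArg Subtype.val (e.injective huv)
        exact Subtype.ext (Subtype.ext (add_right_cancel h1)))
    simpa using this
  have hge : d ≤ Module.finrank ℝ D := by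
    let W : Set (E N) := ⋂ β ∈ K \ {τ}, (conv β)ᶜ
    have hW : IsOpen W := (hfin.subset sdiff_subset).isOpen_biInter fun β _ =>
      isCompact_conv.isClosed.isOpen_compl
    have hWS : ∀ y ∈ shadow K, y ∈ W → y ∈ S := by
      intro y hy hyW
      obtain ⟨β, hβ, hyβ⟩ := mem_iUnion₂.1 hy
      have hyβ' := intrinsicInterior_subset hyβ
      rcases eq_or_ne β τ with rfl | hne
      · exact conv_subset_affineSpan hyβ'
      · exact absurd hyβ' (mem_iInter₂.1 hyW β ⟨hβ, hne⟩)
    let O : Set (E d) := (fun z => ((e.symm z : ↑(shadow K ∩ U)) : E N)) ⁻¹' W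
    have hO : IsOpen O := hW.preimage (continuous_subtype_val.comp e.symm.continuous)
    have hmem : ∀ z : O, ((e.symm z : ↑(shadow K ∩ U)) : E N) - x ∈ D := fun z =>
      AffineSubspace.vsub_mem_direction (hWS _ (e.symm z).2.1 z.2) hxS
    have hxX : x ∈ shadow K ∩ U := ⟨hrel x hxS hxpos, hxU⟩
    have := finrank_le_of_continuous_injective hO ⟨e ⟨x, hxX⟩, by
        simp only [O, mem_preimage, e.symm_apply_apply]
        exact mem_iInter₂.2 fun β hβ => hxβ β hβ.1 hβ.2⟩
      (fun z : O => (⟨_, hmem z⟩ : D))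
      (Continuous.subtype_mk ((continuous_subtype_val.comp
        (e.symm.continuous.comp continuous_subtype_val)).sub continuous_const) _)
      (fun u v huv => by
        have h1 := sub_left_injective (congrArg Subtype.val huv)
        exact Subtype.ext (e.symm.injective (Subtype.ext h1)))
    simpa using this
  omega

/-- Purity: around a point where the shadow is locally Euclidean, every simplex is a face of a
simplex of full dimension. -/
theorem IsGeometricallyRealized.exists_superset_card (hfin : K.Finite)
    (hK : IsGeometricallyRealized K) (hm : ∀ τ ∈ K, m ∈ conv τ)
    (hloc : IsLocallyEuclideanAt d (shadow K) m) (hσ : σ ∈ K) :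
    ∃ τ ∈ K, σ ⊆ τ ∧ τ.card = d + 1 := by
  obtain ⟨τ, hστ, hτ⟩ := hfin.exists_le_maximal hσ
  exact ⟨τ, hτ.prop, hστ, hK.card_of_maximal hfin hloc hτ (hm τ hτ.prop)⟩

end Purity

section Delaunay

variable {N : ℕ}

lemma delaunay_of_subset {Q : Set (E N)} {σ τ : Finset (E N)} (hσ : σ ∈ delaunay Q) (hτ : τ ⊆ σ)
    (hne : τ.Nonempty) : τ ∈ delaunay Q := by
  obtain ⟨-, hQ, c, r, hr, hc, h⟩ := hσ
  exact ⟨hne, fun v hv => hQ (hτ hv), c, r, hr, fun v hv => hc v (hτ hv), h⟩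

lemma finite_setOf_coe_subset {Q : Set (E N)} (hQ : Q.Finite) :
    {σ : Finset (E N) | (σ : Set (E N)) ⊆ Q}.Finite :=
  (hQ.toFinset.powerset).finite_toSet.subset fun σ hσ => by
    simpa [Set.subset_def, Finset.subset_iff] using hσ

/-- The orthogonal projection onto the tangent plane as an affine map. -/
def tangentProjAffine (M : Set (E N)) (m : E N) : E N →ᵃ[ℝ] E N where
  toFun := tangentProj M m
  linear := (tangentDirection M m).starProjection
  map_vadd' x v := by
    simp only [tangentProj, vadd_eq_add, ContinuousLinearMap.coe_coe]
    rw [add_sub_assoc, map_add]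
    abel

lemma convexHull_image_tangentProj (M : Set (E N)) (m : E N) (s : Set (E N)) :
    convexHull ℝ (tangentProj M m '' s) = tangentProj M m '' convexHull ℝ s :=
  ((tangentProjAffine M m).image_convexHull s).symm

open Classical in
lemma conv_image_tangentProj (M : Set (E N)) (m : E N) (σ : Finset (E N)) :
    conv (σ.image (tangentProj M m)) = tangentProj M m '' conv σ := by
  rw [conv, Finset.coe_image, convexHull_image_tangentProj, conv]

end Delaunay

/-- The conditions on a point set and a scale under which the flat Delaunay complex is a faithful
reconstruction. -/
structure StructuralConditions {N : ℕ} (d : ℕ) (M P : Set (E N)) (ρ : ℝ) : Prop where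
  compact : IsCompact M
  submanifold : IsC2Submanifold d M
  finite : P.Finite
  nonneg : 0 ≤ ρ
  lt_reach : ENNReal.ofReal ρ < reach M
  subset_tube : P ⊆ tube M ρ
  projInjOn : ∀ σ, IsSmallSimplex P d ρ σ → InjOn (proj M) (conv σ)
  tangentInjOn : ∀ m ∈ M, InjOn (tangentProj M m) (P ∩ Metric.closedBall m ρ)
  starEuclidean : ∀ m ∈ M, IsLocallyEuclideanAt d (shadow (star M P ρ m)) m
  starRealized : ∀ m ∈ M, IsGeometricallyRealized (star M P ρ m)
  agreement : ∀ σ, IsSmallSimplex P d ρ σ → PrestarsAgree M P ρ σ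

namespace StructuralConditions

variable {N d : ℕ} {M P : Set (E N)} {ρ : ℝ} {m x y : E N} {σ τ : Finset (E N)}

lemma infEDist_lt (h : StructuralConditions d M P ρ) (hm : m ∈ M) (hx : dist x m ≤ ρ) :
    Metric.infEDist x M < reach M := by
  refine ((Metric.infEDist_le_edist_of_mem hm).trans ?_).trans_lt h.lt_reach
  rw [edist_dist]
  exact ENNReal.ofReal_le_ofReal hx

lemma proj_of_mem (h : StructuralConditions d M P ρ) (hm : m ∈ M) : proj M m = m :=
  (isClosestPoint_self hm).proj_eq (h.infEDist_lt hm (by rw [dist_self]; exact h.nonneg))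

lemma proj_mem (h : StructuralConditions d M P ρ) (hm : m ∈ M) (hx : dist x m ≤ ρ) :
    proj M x ∈ M :=
  (isClosestPoint_proj h.compact (h.infEDist_lt hm hx)).1

lemma tangentProj_eq (h : StructuralConditions d M P ρ) (hm : m ∈ M) (hx : dist x m ≤ ρ) :
    tangentProj M (proj M x) x = proj M x :=
  tangentProj_eq_iff.2 (isClosestPoint_proj h.compact (h.infEDist_lt hm hx)).inner_eq_zero

lemma proj_eq (h : StructuralConditions d M P ρ) (hm : m ∈ M) (hx : dist x m ≤ ρ)
    (ht : tangentProj M m x = m) : proj M x = m :=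
  h.submanifold.proj_eq_of_tangentProj_eq h.compact hm h.lt_reach hx ht

lemma prestar_proj (h : StructuralConditions d M P ρ) (hx : proj M x ∈ M) :
    prestar M P ρ (proj M x) = prestar M P ρ x := by
  simp only [prestar, h.proj_of_mem hx]

open Classical in
lemma mem_prestar_iff (h : StructuralConditions d M P ρ) (hm : m ∈ M) : σ ∈ prestar M P ρ m ↔
    (σ : Set (E N)) ⊆ P ∩ Metric.closedBall m ρ ∧
      σ.image (tangentProj M m) ∈ star M P ρ m := by
  simp only [prestar, h.proj_of_mem hm, mem_ofPred_eq]

lemma dist_le_of_mem_conv (h : StructuralConditions d M P ρ) (hm : m ∈ M)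
    (hσ : σ ∈ prestar M P ρ m) (hx : x ∈ conv σ) : dist x m ≤ ρ :=
  convexHull_min (fun _ hv => (((h.mem_prestar_iff hm).1 hσ).1 hv).2)
    (convex_closedBall m ρ) hx

lemma mem_prestar_of_subset (h : StructuralConditions d M P ρ) (hm : m ∈ M)
    (hσ : σ ∈ prestar M P ρ m) (hτ : τ ⊆ σ) (hx : x ∈ conv τ) (hxm : proj M x = m) :
    τ ∈ prestar M P ρ m := by
  classical
  have hd := h.dist_le_of_mem_conv hm hσ (convexHull_mono (Finset.coe_subset.2 hτ) hx)
  rw [h.mem_prestar_iff hm] at hσ ⊢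
  refine ⟨fun v hv => hσ.1 (hτ hv), delaunay_of_subset hσ.2.1 (Finset.image_subset_image hτ)
    ((nonempty_of_mem_conv hx).image _), ?_⟩
  rw [conv_image_tangentProj]
  refine ⟨x, hx, ?_⟩
  have := h.tangentProj_eq hm hd
  rwa [hxm] at this

lemma exists_mem_conv_proj_eq (h : StructuralConditions d M P ρ) (hm : m ∈ M)
    (hσ : σ ∈ prestar M P ρ m) : ∃ x ∈ conv σ, proj M x = m := by
  have h2 := ((h.mem_prestar_iff hm).1 hσ).2.2
  rw [conv_image_tangentProj] at h2
  obtain ⟨x, hx, hxm⟩ := h2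
  exact ⟨x, hx, h.proj_eq hm (h.dist_le_of_mem_conv hm hσ hx) hxm⟩

lemma finite_star (h : StructuralConditions d M P ρ) (m : E N) : (star M P ρ m).Finite :=
  (finite_setOf_coe_subset ((h.finite.subset inter_subset_left).image (tangentProj M m))).subset
    fun _ hτ => hτ.1.2.1

/-- Every simplex of a prestar is a face of a `d`-simplex of that prestar. -/
lemma exists_superset_isSmallSimplex (h : StructuralConditions d M P ρ) (hm : m ∈ M)
    (hσ : σ ∈ prestar M P ρ m) :
    ∃ τ ∈ prestar M P ρ m, σ ⊆ τ ∧ IsSmallSimplex P d ρ τ := by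
  classical
  rw [h.mem_prestar_iff hm] at hσ
  obtain ⟨τ, hτ, hστ, hcard⟩ := (h.starRealized m hm).exists_superset_card (h.finite_star m)
    (fun τ hτ => hτ.2) (h.starEuclidean m hm) hσ.2
  let σ' := h.finite.toFinset.filter fun p => p ∈ Metric.closedBall m ρ ∧ tangentProj M m p ∈ τ
  have hσ' : (σ' : Set (E N)) ⊆ P ∩ Metric.closedBall m ρ := fun p hp => by
    have := Finset.mem_filter.1 (Finset.mem_coe.1 hp)
    exact ⟨h.finite.mem_toFinset.1 this.1, this.2.1⟩
  have himg : σ'.image (tangentProj M m) = τ := by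
    ext v
    refine ⟨fun hv => ?_, fun hv => ?_⟩
    · obtain ⟨p, hp, rfl⟩ := Finset.mem_image.1 hv
      exact (Finset.mem_filter.1 hp).2.2
    · obtain ⟨p, hp, rfl⟩ := hτ.1.2.1 hv
      exact Finset.mem_image_of_mem _
        (Finset.mem_filter.2 ⟨h.finite.mem_toFinset.2 hp.1, hp.2, hv⟩)
  refine ⟨σ', (h.mem_prestar_iff hm).2 ⟨hσ', himg.symm ▸ hτ⟩, fun p hp => ?_,
    fun p hp => (hσ' hp).1, ?_, m, fun p hp => (hσ' hp).2⟩
  · exact Finset.mem_filter.2 ⟨h.finite.mem_toFinset.2 (hσ.1 hp).1, (hσ.1 hp).2,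
      hστ (Finset.mem_image_of_mem _ hp)⟩
  · rw [← hcard, ← himg, Finset.card_image_of_injOn ((h.tangentInjOn m hm).mono hσ')]

lemma mem_prestar_proj (h : StructuralConditions d M P ρ) (hm : m ∈ M)
    (hσ : σ ∈ prestar M P ρ m) (hx : x ∈ conv σ) : σ ∈ prestar M P ρ (proj M x) := by
  obtain ⟨τ, hτ, hστ, hsmall⟩ := h.exists_superset_isSmallSimplex hm hσ
  have hxτ : x ∈ conv τ := convexHull_mono (Finset.coe_subset.2 hστ) hx
  obtain ⟨z, hz, hzm⟩ := h.exists_mem_conv_proj_eq hm hτ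
  have hpx := h.proj_mem hm (h.dist_le_of_mem_conv hm hτ hxτ)
  have hτx : τ ∈ prestar M P ρ (proj M x) := by
    rw [h.prestar_proj hpx, ← h.agreement τ hsmall z hz x hxτ, ← h.prestar_proj (hzm.symm ▸ hm),
      hzm]
    exact hτ
  exact h.mem_prestar_of_subset hpx hτx hστ hx rfl

lemma nonempty_of_mem_prestar (h : StructuralConditions d M P ρ) (hm : m ∈ M)
    (hσ : σ ∈ prestar M P ρ m) : σ.Nonempty := by
  obtain ⟨x, hx, -⟩ := h.exists_mem_conv_proj_eq hm hσ
  exact nonempty_of_mem_conv hx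

lemma mem_flatDel_iff (h : StructuralConditions d M P ρ) :
    σ ∈ flatDel M P ρ ↔ ∃ m ∈ M, σ ∈ prestar M P ρ m := by
  constructor
  · intro hσ
    obtain ⟨p, hp, hσ⟩ := mem_iUnion₂.1 hσ
    have hpr := (isClosestPoint_proj h.compact ((h.subset_tube hp).trans_lt h.lt_reach)).1
    exact ⟨proj M p, hpr, by rwa [h.prestar_proj hpr]⟩
  · rintro ⟨m, hm, hσ⟩
    obtain ⟨p, hp⟩ := h.nonempty_of_mem_prestar hm hσ
    have hpσ : p ∈ conv σ := subset_convexHull ℝ _ hp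
    refine mem_iUnion₂.2 ⟨p, (((h.mem_prestar_iff hm).1 hσ).1 hp).1, ?_⟩
    rw [← h.prestar_proj (h.proj_mem hm (h.dist_le_of_mem_conv hm hσ hpσ))]
    exact h.mem_prestar_proj hm hσ hpσ

lemma mem_prestar_proj_of_mem_flatDel (h : StructuralConditions d M P ρ)
    (hσ : σ ∈ flatDel M P ρ) (hx : x ∈ conv σ) :
    proj M x ∈ M ∧ σ ∈ prestar M P ρ (proj M x) := by
  obtain ⟨m, hm, hσm⟩ := h.mem_flatDel_iff.1 hσ
  exact ⟨h.proj_mem hm (h.dist_le_of_mem_conv hm hσm hx), h.mem_prestar_proj hm hσm hx⟩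

theorem isSimplicialComplex_flatDel (h : StructuralConditions d M P ρ) :
    IsSimplicialComplex (flatDel M P ρ) := by
  intro σ hσ
  obtain ⟨m, hm, hσm⟩ := h.mem_flatDel_iff.1 hσ
  refine ⟨h.nonempty_of_mem_prestar hm hσm, fun τ hτ hne => ?_⟩
  obtain ⟨v, hv⟩ := hne
  have hvσ : v ∈ conv σ := subset_convexHull ℝ _ (hτ hv)
  obtain ⟨hvM, hσv⟩ := h.mem_prestar_proj_of_mem_flatDel hσ hvσ
  exact h.mem_flatDel_iff.2 ⟨_, hvM,
    h.mem_prestar_of_subset hvM hσv hτ (subset_convexHull ℝ _ hv) rfl⟩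

theorem prestar_eq (h : StructuralConditions d M P ρ) (hm : m ∈ M) :
    prestar M P ρ m = {σ | σ ∈ flatDel M P ρ ∧ m ∈ proj M '' conv σ} := by
  ext σ
  constructor
  · intro hσ
    exact ⟨h.mem_flatDel_iff.2 ⟨m, hm, hσ⟩, h.exists_mem_conv_proj_eq hm hσ⟩
  · rintro ⟨hσ, x, hx, rfl⟩
    exact (h.mem_prestar_proj_of_mem_flatDel hσ hx).2

lemma injOn_proj_conv (h : StructuralConditions d M P ρ) (hm : m ∈ M)
    (hσ : σ ∈ prestar M P ρ m) : InjOn (proj M) (conv σ) := by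
  obtain ⟨τ, -, hστ, hsmall⟩ := h.exists_superset_isSmallSimplex hm hσ
  exact (h.projInjOn τ hsmall).mono (convexHull_mono (Finset.coe_subset.2 hστ))

/-- Points of two simplices of the flat Delaunay complex with the same projection coincide, and lie
on the common face. -/
lemma eq_of_proj_eq (h : StructuralConditions d M P ρ) (hσ : σ ∈ flatDel M P ρ)
    (hτ : τ ∈ flatDel M P ρ) (hx : x ∈ conv σ) (hy : y ∈ conv τ) (hxy : proj M x = proj M y) :
    x = y ∧ x ∈ convexHull ℝ ((σ : Set (E N)) ∩ τ) := by
  classical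
  obtain ⟨hm, hσm⟩ := h.mem_prestar_proj_of_mem_flatDel hσ hx
  obtain ⟨-, hτm⟩ := h.mem_prestar_proj_of_mem_flatDel hτ hy
  rw [← hxy] at hτm
  set m := proj M x
  have hσ' := (h.mem_prestar_iff hm).1 hσm
  have hτ' := (h.mem_prestar_iff hm).1 hτm
  have hint := (h.starRealized m hm).inter _ hσ'.2 _ hτ'.2
  rw [Finset.coe_image, Finset.coe_image, ← (h.tangentInjOn m hm).image_inter hσ'.1 hτ'.1,
    convexHull_image_tangentProj] at hint
  obtain ⟨z, hz, hzm⟩ := hint.symm ▸ mem_inter hσ'.2.2 hτ'.2.2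
  have hzσ : z ∈ conv σ := convexHull_mono inter_subset_left hz
  have hzτ : z ∈ conv τ := convexHull_mono inter_subset_right hz
  have hpz : proj M z = m := h.proj_eq hm (h.dist_le_of_mem_conv hm hσm hzσ) hzm
  have hxz : x = z := h.injOn_proj_conv hm hσm hx hzσ hpz.symm
  have hyz : y = z := h.injOn_proj_conv hm hτm hy hzτ (hxy.symm.trans hpz.symm)
  exact ⟨hxz.trans hyz.symm, hxz ▸ hz⟩

theorem isGeometricallyRealized_flatDel (h : StructuralConditions d M P ρ) :
    IsGeometricallyRealized (flatDel M P ρ) where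
  nondegenerate σ hσ := by
    classical
    obtain ⟨m, hm, hσm⟩ := h.mem_flatDel_iff.1 hσ
    have hσ' := (h.mem_prestar_iff hm).1 hσm
    have hinj := (h.tangentInjOn m hm).mono hσ'.1
    let ι : σ ↪ σ.image (tangentProj M m) :=
      ⟨fun v => ⟨tangentProj M m v, Finset.mem_image_of_mem _ v.2⟩, fun u v huv =>
        Subtype.ext (hinj u.2 v.2 (congrArg Subtype.val huv))⟩
    have hind := ((h.starRealized m hm).nondegenerate _ hσ'.2).comp_embedding ι
    have hι : (fun v => (ι v : E N)) = tangentProjAffine M m ∘ ((↑) : σ → E N) := rfl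
    exact AffineIndependent.of_comp (tangentProjAffine M m) (hι ▸ hind)
  inter α hα β hβ := by
    refine Subset.antisymm (subset_inter (convexHull_mono inter_subset_left)
      (convexHull_mono inter_subset_right)) ?_
    rintro x ⟨hxα, hxβ⟩
    exact (h.eq_of_proj_eq hα hβ hxα hxβ rfl).2

lemma finite_flatDel (h : StructuralConditions d M P ρ) : (flatDel M P ρ).Finite :=
  (finite_setOf_coe_subset h.finite).subset fun σ hσ v hv => by
    obtain ⟨m, hm, hσm⟩ := h.mem_flatDel_iff.1 hσ
    exact (((h.mem_prestar_iff hm).1 hσm).1 hv).1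

lemma nonempty_prestar (h : StructuralConditions d M P ρ) (hm : m ∈ M) :
    ∃ σ, σ ∈ prestar M P ρ m := by
  classical
  obtain ⟨τ, hτ, -⟩ := mem_iUnion₂.1 (h.starEuclidean m hm).1
  obtain ⟨σ, hσ, hστ⟩ := Finset.subset_set_image_iff.1 hτ.1.2.1
  exact ⟨σ, (h.mem_prestar_iff hm).2 ⟨hσ, hστ.symm ▸ hτ⟩⟩

theorem isFaithfulReconstruction_flatDel (h : StructuralConditions d M P ρ) :
    IsFaithfulReconstruction (flatDel M P ρ) M := by
  have hshadow := shadow_eq_biUnion_conv h.isSimplicialComplex_flatDel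
    h.isGeometricallyRealized_flatDel
  have hmem : ∀ x ∈ shadow (flatDel M P ρ), ∃ σ ∈ flatDel M P ρ, x ∈ conv σ := fun x hx => by
    rw [hshadow] at hx
    simpa using hx
  have hclose : ∀ x ∈ shadow (flatDel M P ρ), ∃ m ∈ M, dist x m ≤ ρ := fun x hx => by
    obtain ⟨σ, hσ, hxσ⟩ := hmem x hx
    obtain ⟨m, hm, hσm⟩ := h.mem_flatDel_iff.1 hσ
    exact ⟨m, hm, h.dist_le_of_mem_conv hm hσm hxσ⟩
  refine ⟨h.isSimplicialComplex_flatDel, h.isGeometricallyRealized_flatDel,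
    ⟨ρ, h.nonneg, h.lt_reach, fun x hx => ?_⟩, ?_⟩
  · obtain ⟨m, hm, hxm⟩ := hclose x hx
    refine (Metric.infEDist_le_edist_of_mem hm).trans ?_
    rw [edist_dist]
    exact ENNReal.ofReal_le_ofReal hxm
  · have hcomp : CompactSpace (shadow (flatDel M P ρ)) := by
      rw [← isCompact_iff_compactSpace, hshadow]
      exact h.finite_flatDel.isCompact_biUnion fun _ _ => isCompact_conv
    have hpM : ∀ x : shadow (flatDel M P ρ), proj M x ∈ M := fun x => by
      obtain ⟨m, hm, hxm⟩ := hclose x x.2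
      exact h.proj_mem hm hxm
    let f : shadow (flatDel M P ρ) → M := fun x => ⟨proj M x, hpM x⟩
    have hf : Continuous f := by
      refine Continuous.subtype_mk ?_ _
      refine continuousOn_iff_continuous_domRestrict.1
        ((continuousOn_proj h.compact).mono fun x hx => ?_)
      obtain ⟨m, hm, hxm⟩ := hclose x hx
      exact h.infEDist_lt hm hxm
    have hbij : Function.Bijective f := by
      constructor
      · intro x y hxy
        obtain ⟨σ, hσ, hxσ⟩ := hmem x x.2
        obtain ⟨τ, hτ, hyτ⟩ := hmem y y.2
        exact Subtype.ext (h.eq_of_proj_eq hσ hτ hxσ hyτ (congrArg Subtype.val hxy)).1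
      · rintro ⟨m, hm⟩
        obtain ⟨σ, hσ⟩ := h.nonempty_prestar hm
        obtain ⟨x, hx, hxm⟩ := h.exists_mem_conv_proj_eq hm hσ
        refine ⟨⟨x, ?_⟩, Subtype.ext hxm⟩
        rw [hshadow]
        exact mem_iUnion₂.2 ⟨σ, h.mem_flatDel_iff.2 ⟨m, hm, hσ⟩, hx⟩
    exact ⟨Continuous.homeoOfEquivCompactToT2 (f := Equiv.ofBijective f hbij) hf, fun _ => rfl⟩

end StructuralConditions

end FlatDelaunay

end

theorem mainTheorem1 {N d : ℕ} (hdN : d < N)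
    (M : Set (FlatDelaunay.E N)) (hMcompact : IsCompact M)
    (hM : FlatDelaunay.IsC2Submanifold d M)
    (R : ℝ) (hR : 0 < R) (hRreach : ENNReal.ofReal R ≤ FlatDelaunay.reach M)
    (P : Set (FlatDelaunay.E N)) (hPfinite : P.Finite)
    (ρ : ℝ) (hρ0 : 0 ≤ ρ) (hρR : ρ < R / 2)
    (hP : P ⊆ FlatDelaunay.tube M ρ)
    (projInjOn : ∀ σ, FlatDelaunay.IsSmallSimplex P d ρ σ →
      Set.InjOn (FlatDelaunay.proj M) (FlatDelaunay.conv σ))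
    (tangentInjOn : ∀ m ∈ M,
      Set.InjOn (FlatDelaunay.tangentProj M m) (P ∩ Metric.closedBall m ρ))
    (starEuclidean : ∀ m ∈ M,
      FlatDelaunay.IsLocallyEuclideanAt d
        (FlatDelaunay.shadow (FlatDelaunay.star M P ρ m)) m)
    (starRealized : ∀ m ∈ M,
      FlatDelaunay.IsGeometricallyRealized (FlatDelaunay.star M P ρ m))
    (agreement : ∀ σ, FlatDelaunay.IsSmallSimplex P d ρ σ →
      FlatDelaunay.PrestarsAgree M P ρ σ) :
    FlatDelaunay.IsSimplicialComplex (FlatDelaunay.flatDel M P ρ) ∧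
    (∀ m ∈ M, FlatDelaunay.prestar M P ρ m =
      {σ | σ ∈ FlatDelaunay.flatDel M P ρ ∧
        m ∈ FlatDelaunay.proj M '' FlatDelaunay.conv σ}) ∧
    FlatDelaunay.IsFaithfulReconstruction (FlatDelaunay.flatDel M P ρ) M := by
  have h : FlatDelaunay.StructuralConditions d M P ρ :=
    { compact := hMcompact
      submanifold := hM
      finite := hPfinite
      nonneg := hρ0
      lt_reach := ((ENNReal.ofReal_lt_ofReal_iff hR).2 (by linarith)).trans_le hRreach
      subset_tube := hP
      projInjOn := projInjOn
      tangentInjOn := tangentInjOn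
      starEuclidean := starEuclidean
      starRealized := starRealized
      agreement := agreement }
  exact ⟨h.isSimplicialComplex_flatDel, fun m hm => h.prestar_eq hm,
    h.isFaithfulReconstruction_flatDel⟩
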